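/- Let $U$ be the universe of a connected 1-linkoid diagram in $S^2$: a connected graph embedded in the sphere, with finitely many vertices, two of which (the tail and the head) have degree $1$ while all others (the crossings) have degree $4$. Put the star in the region that contains the tail, and regard that region as the exterior one. A clock state of $U$ is a choice of one marker at each crossing, in one of the four corners at that crossing, such that every unstarred region contains exactly one marker and the starred region contains none. A clockwise clock move changes a clock state into another one in one of two ways: (i) two markers at different crossings each rotate by $90$ degrees clockwise about their crossings and thereby exchange the two regions in which they lie, while all other markers stay; (ii) one marker rotates by $90$ degrees clockwise about its crossing, across the edge of the strand that ends at the head (this strand may pass through a knotted portion: the edge is one whose removal separates the crossing from the head), and stays in its region, while all other markers stay. Counterclockwise clock moves are the inverses of clockwise ones. A clock state is clocked if it admits no counterclockwise clock move. Then $U$ has exactly one clocked state, and every clock state of $U$ can be obtained from it by a finite (possibly empty) sequence of clock moves, all of them in the clockwise direction. -/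

import Mathlib

/-- The half-edges of the universe of a 1-linkoid diagram with set of crossings `C`: four at every
crossing, numbered in counterclockwise order, and one at each of the two endpoints. -/
inductive Dart (C : Type*) where
  | cross (c : C) (i : ZMod 4) : Dart C
  | tail : Dart C
  | head : Dart C

/-- Rotation around a vertex: each half-edge goes to the next one, counterclockwise, at the same
vertex. The two endpoints have degree one, so their half-edges are fixed. -/
def Dart.rot (C : Type*) : Equiv.Perm (Dart C) where
  toFun
    | .cross c i => .cross c (i + 1)
    | .tail => .tail
    | .head => .head
  invFun
    | .cross c i => .cross c (i - 1)
    | .tail => .tail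
    | .head => .head
  left_inv x := by cases x <;> simp
  right_inv x := by cases x <;> simp

/-- The cycles (including the fixed points) of a permutation. -/
def PermOrbit {D : Type*} (p : Equiv.Perm D) : Type _ :=
  Quotient (Equiv.Perm.SameCycle.setoid p)

/-- The universe (underlying plane graph, over/under information forgotten) of a connected
1-linkoid diagram in the sphere, as a combinatorial map. `opp` exchanges the two half-edges of each
edge. A half-edge `x` is directed away from its vertex; the face on its left continues along
`rot⁻¹ (opp x)`, so that vertices, edges and faces are the cycles of `rot`, `opp` and
`rot⁻¹ * opp`. By Euler's formula the surface is the sphere. -/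
structure LinkoidUniverse (C : Type*) where
  opp : Equiv.Perm (Dart C)
  opp_opp : ∀ x, opp (opp x) = x
  opp_ne : ∀ x, opp x ≠ x
  connected : ∀ x y, Relation.ReflTransGen (fun a b => b = Dart.rot C a ∨ b = opp a) x y
  euler : Nat.card (PermOrbit (Dart.rot C)) + Nat.card (PermOrbit ((Dart.rot C)⁻¹ * opp))
    = Nat.card (PermOrbit opp) + 2

namespace LinkoidUniverse

variable {C : Type*} (U : LinkoidUniverse C)

/-- The regions of the universe. -/
def Face : Type _ := PermOrbit ((Dart.rot C)⁻¹ * U.opp)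

/-- The region to the left of a half-edge. -/
def leftFace (x : Dart C) : U.Face :=
  Quotient.mk (Equiv.Perm.SameCycle.setoid ((Dart.rot C)⁻¹ * U.opp)) x

/-- The starred (exterior) region: the one that contains the tail. -/
def star : U.Face := U.leftFace .tail

/-- The region that contains the `i`-th corner (local region) at the crossing `c`, the corner
between the half-edges `i` and `i + 1`. -/
def cornerFace (c : C) (i : ZMod 4) : U.Face := U.leftFace (.cross c i)

/-- A clock state: one marker at each crossing, in one of its four corners, such that the starred
region has no marker and every other region has exactly one. -/
@[ext]
structure ClockState where
  corner : C → ZMod 4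
  ne_star : ∀ c, U.cornerFace c (corner c) ≠ U.star
  existsUnique_marker : ∀ f : U.Face, f ≠ U.star → ∃! c, U.cornerFace c (corner c) = f

/-- The edge of `x`, followed away from the vertex of `x`, is the strand that ends at the head,
possibly after passing through a knotted portion: if this edge is cut, then the vertex of `x` is
no longer connected with the head. -/
def LeadsToHead (x : Dart C) : Prop :=
  ¬ Relation.ReflTransGen
      (fun a b => b = Dart.rot C a ∨ (b = U.opp a ∧ a ≠ x ∧ a ≠ U.opp x)) x .head

namespace ClockState

variable {U}

/-- The first kind of clock move, clockwise: two markers, in regions `A` and `B` that share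
boundary edges, rotate by 90 degrees clockwise (corner `i` to corner `i - 1`, across half-edge
`i`) and thereby exchange their regions. All other markers stay. -/
def DoubleClockwise (s t : U.ClockState) : Prop :=
  ∃ c d : C, c ≠ d ∧
    t.corner c = s.corner c - 1 ∧ t.corner d = s.corner d - 1 ∧
    U.cornerFace c (t.corner c) = U.cornerFace d (s.corner d) ∧
    U.cornerFace d (t.corner d) = U.cornerFace c (s.corner c) ∧
    ∀ b, b ≠ c → b ≠ d → t.corner b = s.corner b

/-- The second kind of clock move, clockwise: one marker rotates by 90 degrees clockwise, across
the strand that ends at the head, and stays in its region. All other markers stay. -/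
def SingleClockwise (s t : U.ClockState) : Prop :=
  ∃ c : C, U.LeadsToHead (.cross c (s.corner c)) ∧
    t.corner c = s.corner c - 1 ∧
    U.cornerFace c (t.corner c) = U.cornerFace c (s.corner c) ∧
    ∀ b, b ≠ c → t.corner b = s.corner b

/-- `t` arises from `s` by one clock move in the clockwise direction. -/
def ClockwiseMove (s t : U.ClockState) : Prop :=
  DoubleClockwise s t ∨ SingleClockwise s t

/-- `t` arises from `s` by one clock move in the counterclockwise direction, that is, by the
inverse of a clockwise one. -/
def CounterclockwiseMove (s t : U.ClockState) : Prop := ClockwiseMove t s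

/-- A clocked state admits clock moves only in the clockwise direction. -/
def IsClocked (s : U.ClockState) : Prop := ∀ t, ¬ CounterclockwiseMove s t

end ClockState

end LinkoidUniverse

/-!
Three facts about the plane carry the proof. All of them come from one chain complex: functions on
the edges are sent to their differences at corners (`edgeCoboundary`), and functions on the
vertices and faces to their differences at corners (`cellBoundary`). The two ranges are orthogonal,
and Euler's formula says that together they fill up the space of functions on corners.

* A function on corners that sums to zero around all vertices and faces is the coboundary of a
  height function on edges (`exists_height`). A circulation along corners has winding numbers
  (`exists_winding`).
* A connected proper region has Euler characteristic at most one (`euler_inequality`).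
* As a consequence, any nonempty set of crossings touches more faces than it has elements
  (`card_lt_card_facesAt`). By Hall's marriage theorem clock states exist.

The difference of the marker indicators of two states `s`, `t` sums to zero around all vertices and
faces, so it is the coboundary of a function `relHeight s t` on edges, normalized to vanish at the
tail. It vanishes only if `s = t`. A clockwise move from `s` to `t` satisfies `relHeight s t ≥ 0`,
with strict inequality somewhere (`ClockwiseMove.relHeight_nonneg`): the move raises by one all
edges on one side of a cut, and Hall's condition (for double moves) or a parity argument (for single
moves) shows that the tail is on the other side. Hence counterclockwise moves cannot be continued
forever, and every state is reached by clockwise moves from some clocked state.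

It remains to see that a state `s` which is somewhere higher than another state `t` admits a
counterclockwise move (`exists_clockwiseMove_of_relHeight_pos`); then two clocked states have the
same heights and are equal. The set where `relHeight t s > 0` is lowerable: around a crossing, it
contains an initial segment of the sequence of half-edges that begins counterclockwise after the
marker. Filling the parts of the complement that do not contain the tail keeps this property, so
there is a minimal lowerable set `F` with connected complement (`IsBlock`). At a crossing that is
not inside `F` such a set has at most one half-edge (`notMem_of_minimal`): two of them would lie on
a closed walk inside `F` that turns around this crossing with positive winding number, whereas the
complement of `F` connects the crossing with the tail, where the winding number is zero. The bound
on the Euler characteristic now leaves two possibilities for the boundary of `F`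
(`card_boundary_of_minimal`): two crossings, which exchange the faces of their markers, or one
crossing, with the head in `F`. These are the two kinds of clock moves.
-/

/-! ### Half-edges, vertices, edges and faces -/

namespace Dart

variable {C : Type*}

@[simp] theorem rot_cross (c : C) (i : ZMod 4) : rot C (cross c i) = cross c (i + 1) := rfl
@[simp] theorem rot_tail : rot C (tail : Dart C) = tail := rfl
@[simp] theorem rot_head : rot C (head : Dart C) = head := rfl

/-- The vertex of a half-edge: a crossing, or one of the endpoints `false` (tail), `true` (head). -/
def vert : Dart C → C ⊕ Bool
  | cross c _ => Sum.inl c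
  | tail => Sum.inr false
  | head => Sum.inr true

@[simp] theorem vert_cross (c : C) (i : ZMod 4) : vert (cross c i) = Sum.inl c := rfl
@[simp] theorem vert_tail : vert (tail : Dart C) = Sum.inr false := rfl
@[simp] theorem vert_head : vert (head : Dart C) = Sum.inr true := rfl

@[simp] theorem vert_rot (x : Dart C) : vert (rot C x) = vert x := by cases x <;> rfl

theorem vert_eq_inl {x : Dart C} {c : C} (h : vert x = Sum.inl c) : ∃ i, x = cross c i := by
  cases x with
  | cross d i => exact ⟨i, by simp at h; rw [h]⟩
  | tail => simp at h
  | head => simp at h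

theorem vert_surjective : Function.Surjective (vert : Dart C → C ⊕ Bool) := by
  rintro (c | _ | _)
  exacts [⟨cross c 0, rfl⟩, ⟨tail, rfl⟩, ⟨head, rfl⟩]

/-- The half-edges are four for every crossing, together with the two ends. -/
def equivSum : Dart C ≃ (C × ZMod 4) ⊕ Bool where
  toFun
    | cross c i => Sum.inl (c, i)
    | tail => Sum.inr false
    | head => Sum.inr true
  invFun
    | Sum.inl (c, i) => cross c i
    | Sum.inr false => tail
    | Sum.inr true => head
  left_inv x := by cases x <;> rfl
  right_inv x := by rcases x with _ | _ | _ <;> rfl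

noncomputable instance [Fintype C] : Fintype (Dart C) := Fintype.ofEquiv _ equivSum.symm

theorem sum_eq [Fintype C] {M : Type*} [AddCommMonoid M] (g : Dart C → M) :
    ∑ x, g x = ∑ c, ∑ i, g (cross c i) + (g tail + g head) := by
  rw [← equivSum.symm.sum_comp, Fintype.sum_sum_type, Fintype.sum_prod_type]
  simp [equivSum, add_comm]

theorem card_eq [Fintype C] : Fintype.card (Dart C) = 4 * Fintype.card C + 2 := by
  rw [Fintype.card_congr equivSum, Fintype.card_sum, Fintype.card_prod, ZMod.card,
    Fintype.card_bool, mul_comm]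

theorem eq_iff_of_sameCycle_rot (x y : Dart C) : (rot C).SameCycle x y ↔ vert x = vert y := by
  constructor
  · rintro ⟨i, rfl⟩
    induction i with
    | zero => rfl
    | succ n ih => rw [add_comm, zpow_add, zpow_one, Equiv.Perm.mul_apply, vert_rot, ih]
    | pred n ih =>
      rw [ih, ← vert_rot ((rot C ^ (-(n : ℤ) - 1)) x), ← Equiv.Perm.mul_apply, ← zpow_one_add]
      congr 3
      ring
  · intro h
    cases x with
    | cross c i =>
      obtain ⟨j, rfl⟩ := vert_eq_inl h.symm
      refine ⟨((j - i).val : ℕ), ?_⟩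
      have key : ∀ (k : ℕ), (rot C ^ k) (cross c i) = cross c (i + k) := by
        intro k
        induction k with
        | zero => simp
        | succ k ih =>
          rw [pow_succ', Equiv.Perm.mul_apply, ih, rot_cross, Nat.cast_succ, add_assoc]
      rw [zpow_natCast, key]
      simp
    | tail => cases y <;> simp at h ⊢; exact Equiv.Perm.SameCycle.refl _ _
    | head => cases y <;> simp at h ⊢; exact Equiv.Perm.SameCycle.refl _ _

theorem card_permOrbit_rot [Fintype C] : Nat.card (PermOrbit (rot C)) = Fintype.card C + 2 := by
  have e : PermOrbit (rot C) ≃ C ⊕ Bool :=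
    Equiv.ofBijective (Quotient.lift vert fun x y h => (eq_iff_of_sameCycle_rot x y).1 h) <| by
      constructor
      · rintro ⟨x⟩ ⟨y⟩ h
        exact Quotient.sound ((eq_iff_of_sameCycle_rot x y).2 h)
      · intro v
        obtain ⟨x, rfl⟩ := vert_surjective v
        exact ⟨Quotient.mk _ x, rfl⟩
  rw [Nat.card_congr e, Nat.card_eq_fintype_card, Fintype.card_sum, Fintype.card_bool]

end Dart

namespace LinkoidUniverse

open scoped Classical

variable {C : Type*} (U : LinkoidUniverse C)

theorem leftFace_next (x : Dart C) : U.leftFace ((Dart.rot C)⁻¹ (U.opp x)) = U.leftFace x :=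
  Quotient.sound ⟨-1, by simp⟩

theorem leftFace_opp (x : Dart C) : U.leftFace (U.opp x) = U.leftFace ((Dart.rot C)⁻¹ x) := by
  rw [← U.leftFace_next (U.opp x), U.opp_opp]

theorem leftFace_opp_rot (x : Dart C) : U.leftFace (U.opp (Dart.rot C x)) = U.leftFace x := by
  rw [leftFace_opp]; simp

theorem leftFace_surjective : Function.Surjective U.leftFace := Quotient.mk_surjective

/-- A property that passes from every half-edge to the next one of the same face passes around
faces. -/
theorem of_leftFace_eq [Finite C] {P : Dart C → Prop}
    (h : ∀ x, P x → P ((Dart.rot C)⁻¹ (U.opp x))) {x y : Dart C}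
    (hxy : U.leftFace x = U.leftFace y) (hx : P x) : P y := by
  have := Fintype.ofFinite C
  obtain ⟨n, -, -, rfl⟩ := (Quotient.exact hxy : Equiv.Perm.SameCycle _ x y).exists_pow_eq''
  clear hxy
  induction n with
  | zero => simpa
  | succ n ih => rw [pow_succ', Equiv.Perm.mul_apply]; exact h _ ih

theorem of_closed {P : Dart C → Prop} (hrot : ∀ x, P x → P (Dart.rot C x))
    (hopp : ∀ x, P x → P (U.opp x)) {x : Dart C} (hx : P x) (y : Dart C) : P y := by
  induction U.connected x y with
  | refl => exact hx
  | tail _ h ih =>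
    rcases h with rfl | rfl
    exacts [hrot _ ih, hopp _ ih]

/-- The edge of a half-edge. -/
def edge (x : Dart C) : PermOrbit U.opp := Quotient.mk (Equiv.Perm.SameCycle.setoid U.opp) x

theorem edge_opp (x : Dart C) : U.edge (U.opp x) = U.edge x := Quotient.sound ⟨-1, by simp⟩

theorem edge_eq_iff {x y : Dart C} : U.edge x = U.edge y ↔ y = x ∨ y = U.opp x := by
  constructor
  · intro h
    obtain ⟨i, hi⟩ := (Quotient.exact h : Equiv.Perm.SameCycle _ x y)
    have h2 : U.opp ^ (2 : ℤ) = 1 := by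
      ext x
      rw [zpow_two, Equiv.Perm.mul_apply, U.opp_opp, Equiv.Perm.one_apply]
    rcases Int.even_or_odd' i with ⟨k, rfl | rfl⟩
    · rw [zpow_mul, h2, one_zpow] at hi
      exact Or.inl hi.symm
    · rw [zpow_add, zpow_mul, h2, one_zpow, one_mul, zpow_one] at hi
      exact Or.inr hi.symm
  · rintro (rfl | rfl)
    exacts [rfl, (U.edge_opp x).symm]

/-- A set of edges, given as a set of half-edges that is closed under `opp`. -/
def IsEdgeSet (D : Set (Dart C)) : Prop := ∀ x ∈ D, U.opp x ∈ D

variable {U} in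
theorem IsEdgeSet.opp_mem_iff {D : Set (Dart C)} (hD : U.IsEdgeSet D) {x : Dart C} :
    U.opp x ∈ D ↔ x ∈ D :=
  ⟨fun h => by simpa [U.opp_opp] using hD _ h, hD x⟩

variable {U} in
theorem IsEdgeSet.compl {D : Set (Dart C)} (hD : U.IsEdgeSet D) : U.IsEdgeSet Dᶜ :=
  fun _ hx h => hx (hD.opp_mem_iff.1 h)

/-- The edges of the half-edges in `D`. -/
def edges (D : Set (Dart C)) : Set (PermOrbit U.opp) := {e | ∃ x ∈ D, U.edge x = e}

theorem edge_mem_edges {D : Set (Dart C)} {x : Dart C} (hx : x ∈ D) : U.edge x ∈ U.edges D :=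
  ⟨x, hx, rfl⟩

section Sums

noncomputable instance {D : Type*} [Finite D] (p : Equiv.Perm D) : Fintype (PermOrbit p) :=
  have : Finite (PermOrbit p) := inferInstanceAs (Finite (Quotient _))
  Fintype.ofFinite _

variable [Fintype C]

noncomputable instance : Fintype U.Face := inferInstanceAs (Fintype (PermOrbit _))

/-- An edge set consists of an even number of half-edges. -/
theorem two_mul_card_edges (D : Set (Dart C)) (hD : U.IsEdgeSet D) :
    2 * Fintype.card (U.edges D) =
      (Finset.univ.filter (· ∈ D)).card := by
  rw [Finset.card_eq_sum_card_fiberwise (f := U.edge)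
    (t := Finset.univ.filter (· ∈ U.edges D))]
  · rw [Finset.sum_const_nat (m := 2), Fintype.card_subtype, mul_comm]
    intro e he
    obtain ⟨x, hx, rfl⟩ := (Finset.mem_filter.1 he).2
    have : (Finset.univ.filter (· ∈ D)).filter (fun y => U.edge y = U.edge x) = {x, U.opp x} := by
      ext y
      simp only [Finset.mem_filter, Finset.mem_univ, true_and, Finset.mem_insert,
        Finset.mem_singleton]
      rw [eq_comm, edge_eq_iff]
      constructor
      · exact fun h => h.2
      · rintro (rfl | rfl)
        exacts [⟨hx, Or.inl rfl⟩, ⟨hD _ hx, Or.inr rfl⟩]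
    rw [this, Finset.card_pair (U.opp_ne x).symm]
  · intro x hx
    simp only [Finset.coe_filter, Finset.mem_univ, true_and, Set.mem_ofPred_eq] at hx ⊢
    exact ⟨x, hx, rfl⟩

theorem card_edges_univ : Fintype.card (U.edges Set.univ) = 2 * Fintype.card C + 1 := by
  have h := U.two_mul_card_edges Set.univ fun _ _ => Set.mem_univ _
  simp only [Set.mem_univ, Finset.filter_true, Finset.card_univ, Dart.card_eq] at h
  omega

theorem card_face : Fintype.card U.Face = Fintype.card C + 1 := by
  have h := U.euler
  have h2 := U.card_edges_univ
  have e : U.edges Set.univ ≃ PermOrbit U.opp := Equiv.subtypeUnivEquiv fun e => by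
    obtain ⟨x, rfl⟩ := Quotient.mk_surjective e
    exact ⟨x, trivial, rfl⟩
  rw [← Nat.card_eq_fintype_card, Nat.card_congr e] at h2
  have h3 : Nat.card (PermOrbit ((Dart.rot C)⁻¹ * U.opp)) = Fintype.card U.Face :=
    Nat.card_eq_fintype_card (α := U.Face)
  rw [Dart.card_permOrbit_rot] at h
  omega

/-- Around every vertex the differences of a function at consecutive half-edges add up to `0`. -/
theorem sum_sub_mul_vert (g : Dart C → ℚ) (a : C ⊕ Bool → ℚ) :
    ∑ x, (g (Dart.rot C x) - g x) * a (Dart.vert x) = 0 := by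
  simp only [sub_mul, Finset.sum_sub_distrib]
  rw [sub_eq_zero, ← Equiv.sum_comp (Dart.rot C) fun x => g x * a (Dart.vert x)]
  simp

/-- Around every face the differences of a function on the edges add up to `0`: the corner at `x`
lies between the edges of `x` and of `rot x`, and these are consecutive edges of the face. -/
theorem sum_sub_mul_leftFace (g : Dart C → ℚ) (hg : ∀ x, g (U.opp x) = g x) (b : U.Face → ℚ) :
    ∑ x, (g (Dart.rot C x) - g x) * b (U.leftFace x) = 0 := by
  simp only [sub_mul, Finset.sum_sub_distrib]
  rw [sub_eq_zero, ← Equiv.sum_comp ((Dart.rot C)⁻¹ * U.opp)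
    fun x => g (Dart.rot C x) * b (U.leftFace x)]
  refine Finset.sum_congr rfl fun x _ => ?_
  rw [Equiv.Perm.mul_apply, leftFace_next]
  simp [hg]

end Sums

end LinkoidUniverse

/-! ### Orthogonal pairs of linear maps -/

section Orthogonal

variable {X A B : Type*} [Fintype X] [AddCommGroup A] [Module ℚ A] [AddCommGroup B] [Module ℚ B]
  {d : A →ₗ[ℚ] X → ℚ} {j : B →ₗ[ℚ] X → ℚ}

theorem disjoint_range_of_orthogonal (h : ∀ a b, ∑ x, d a x * j b x = 0) :
    Disjoint (LinearMap.range d) (LinearMap.range j) := by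
  rw [Submodule.disjoint_def]
  rintro z ⟨a, rfl⟩ ⟨b, hb⟩
  have h1 := h a b
  rw [hb] at h1
  rw [Finset.sum_eq_zero_iff_of_nonneg fun x _ => mul_self_nonneg _] at h1
  ext x
  simpa using h1 x (Finset.mem_univ x)

theorem finrank_range_add_le_of_orthogonal (h : ∀ a b, ∑ x, d a x * j b x = 0) :
    Module.finrank ℚ (LinearMap.range d) + Module.finrank ℚ (LinearMap.range j)
      ≤ Fintype.card X := by
  have := Submodule.finrank_add_finrank_le_of_disjoint (disjoint_range_of_orthogonal h)
  simpa using this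

/-- If the ranges of two mutually orthogonal maps are as large as possible, then everything that
is orthogonal to one range lies in the other one. -/
theorem mem_range_of_orthogonal (h : ∀ a b, ∑ x, d a x * j b x = 0)
    (hX : Fintype.card X ≤
      Module.finrank ℚ (LinearMap.range d) + Module.finrank ℚ (LinearMap.range j))
    {z : X → ℚ} (hz : ∀ b, ∑ x, z x * j b x = 0) : z ∈ LinearMap.range d := by
  have htop : LinearMap.range d ⊔ LinearMap.range j = ⊤ := by
    apply Submodule.eq_top_of_finrank_eq
    have h1 := Submodule.finrank_sup_add_finrank_inf_eq (LinearMap.range d) (LinearMap.range j)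
    rw [(disjoint_range_of_orthogonal h).eq_bot, finrank_bot] at h1
    have h2 := Submodule.finrank_le (LinearMap.range d ⊔ LinearMap.range j)
    rw [Module.finrank_pi] at *
    omega
  obtain ⟨_, ⟨a, rfl⟩, _, ⟨b, rfl⟩, rfl⟩ := Submodule.mem_sup.1 (htop ▸ Submodule.mem_top (x := z))
  have h1 := hz b
  simp only [Pi.add_apply, add_mul, Finset.sum_add_distrib, h a b, zero_add] at h1
  rw [Finset.sum_eq_zero_iff_of_nonneg fun x _ => mul_self_nonneg _] at h1
  have : j b = 0 := by
    ext x
    simpa using h1 x (Finset.mem_univ x)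
  rw [this, add_zero]
  exact ⟨a, rfl⟩

end Orthogonal

namespace LinkoidUniverse

open scoped Classical

variable {C : Type*} (U : LinkoidUniverse C)

/-! ### The chain complex of corners -/

/-- A set of half-edges is connected through corners if any two of its elements are joined by
steps inside the set, each of which goes to the other half of the edge or to a neighbour around
the vertex. -/
def CornerConnected (D : Set (Dart C)) : Prop :=
  ∀ P : Dart C → Prop, (∀ x ∈ D, P x → P (U.opp x)) →
    (∀ x ∈ D, Dart.rot C x ∈ D → (P x ↔ P (Dart.rot C x))) → ∀ x ∈ D, P x → ∀ y ∈ D, P y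

/-- The corners between two half-edges of `D`. -/
def innerCorners (D : Set (Dart C)) : Set (Dart C) := {x | x ∈ D ∧ Dart.rot C x ∈ D}

/-- The vertices all of whose half-edges lie in `D`. -/
def innerVertices (D : Set (Dart C)) : Set (C ⊕ Bool) := {v | ∀ x, Dart.vert x = v → x ∈ D}

/-- The faces all of whose half-edges lie in `D`. -/
def innerFaces (D : Set (Dart C)) : Set U.Face := {f | ∀ x, U.leftFace x = f → x ∈ D}

/-- Extension by zero. -/
noncomputable def zeroExt {α : Type*} (S : Set α) : (↥S → ℚ) →ₗ[ℚ] α → ℚ :=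
  Function.ExtendByZero.linearMap ℚ (Subtype.val : ↥S → α)

theorem zeroExt_mem {α : Type*} {S : Set α} (f : S → ℚ) {a : α} (ha : a ∈ S) :
    zeroExt S f a = f ⟨a, ha⟩ :=
  Function.Injective.extend_apply Subtype.val_injective f (0 : α → ℚ) ⟨a, ha⟩

theorem zeroExt_notMem {α : Type*} {S : Set α} (f : S → ℚ) {a : α} (ha : a ∉ S) :
    zeroExt S f a = 0 :=
  Function.extend_apply' f (0 : α → ℚ) a fun ⟨b, hb⟩ => ha (hb ▸ b.2)

/-- The coboundary of a function on the edges of `D`: at the corner between `x` and `rot x`, the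
difference of its values at these two edges. -/
noncomputable def edgeCoboundary (D : Set (Dart C)) :
    (U.edges D → ℚ) →ₗ[ℚ] innerCorners D → ℚ :=
  LinearMap.funLeft ℚ ℚ Subtype.val ∘ₗ
    (LinearMap.funLeft ℚ ℚ (Dart.rot C) - LinearMap.id) ∘ₗ
      LinearMap.funLeft ℚ ℚ U.edge ∘ₗ zeroExt (U.edges D)

/-- The boundary of a function on the inner vertices and faces of `D`: at each corner, the
difference of the values at its vertex and at its face. -/
noncomputable def cellBoundary (D : Set (Dart C)) :
    (innerVertices D → ℚ) × (U.innerFaces D → ℚ) →ₗ[ℚ] innerCorners D → ℚ :=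
  LinearMap.funLeft ℚ ℚ Subtype.val ∘ₗ
    ((LinearMap.funLeft ℚ ℚ Dart.vert ∘ₗ zeroExt (innerVertices D)).coprod
      (-(LinearMap.funLeft ℚ ℚ U.leftFace ∘ₗ zeroExt (U.innerFaces D))))

theorem edgeCoboundary_apply (D : Set (Dart C)) (h : U.edges D → ℚ) (x : innerCorners D) :
    U.edgeCoboundary D h x =
      zeroExt (U.edges D) h (U.edge (Dart.rot C x)) - zeroExt (U.edges D) h (U.edge x) := rfl

theorem cellBoundary_apply (D : Set (Dart C)) (p : (innerVertices D → ℚ) × (U.innerFaces D → ℚ))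
    (x : innerCorners D) :
    U.cellBoundary D p x = zeroExt (innerVertices D) p.1 (Dart.vert x.1) -
      zeroExt (U.innerFaces D) p.2 (U.leftFace x) := by
  simp [cellBoundary, LinearMap.funLeft_apply, sub_eq_add_neg]

variable {U}

theorem zeroExt_innerVertices {D : Set (Dart C)} {f : innerVertices D → ℚ} {x : Dart C}
    (hx : x ∉ innerCorners D) : zeroExt _ f (Dart.vert x) = 0 :=
  zeroExt_notMem _ fun h => hx ⟨h x rfl, h _ (Dart.vert_rot x)⟩

theorem zeroExt_innerFaces {D : Set (Dart C)} (hD : U.IsEdgeSet D) {f : U.innerFaces D → ℚ}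
    {x : Dart C} (hx : x ∉ innerCorners D) : zeroExt _ f (U.leftFace x) = 0 :=
  zeroExt_notMem _ fun h => hx ⟨h x rfl, hD.opp_mem_iff.1 (h _ (U.leftFace_opp_rot x))⟩

theorem isEdgeSet_univ (U : LinkoidUniverse C) : U.IsEdgeSet Set.univ := fun _ _ => trivial

theorem cornerConnected_univ (U : LinkoidUniverse C) : U.CornerConnected Set.univ :=
  fun P h1 h2 _ _ hx y _ => U.of_closed (P := P)
    (fun x hx => (h2 x trivial trivial).1 hx) (fun x hx => h1 x trivial hx) hx y

/-- A chain of inner vertices and faces without boundary has the same value everywhere. -/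
theorem eq_of_cellBoundary_eq_zero {D : Set (Dart C)} (hD : U.IsEdgeSet D)
    {p : (innerVertices D → ℚ) × (U.innerFaces D → ℚ)} (hp : U.cellBoundary D p = 0)
    (x y : Dart C) :
    zeroExt (innerVertices D) p.1 (Dart.vert y) = zeroExt (innerVertices D) p.1 (Dart.vert x) ∧
    zeroExt (U.innerFaces D) p.2 (U.leftFace y) =
      zeroExt (innerVertices D) p.1 (Dart.vert x) := by
  have h1 (z : Dart C) : zeroExt (innerVertices D) p.1 (Dart.vert z) =
      zeroExt (U.innerFaces D) p.2 (U.leftFace z) := by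
    by_cases hz : z ∈ innerCorners D
    · have := congrFun hp ⟨z, hz⟩
      rwa [cellBoundary_apply, Pi.zero_apply, sub_eq_zero] at this
    · rw [zeroExt_innerVertices hz, zeroExt_innerFaces hD hz]
  have h2 : zeroExt (innerVertices D) p.1 (Dart.vert y) =
      zeroExt (innerVertices D) p.1 (Dart.vert x) := by
    refine U.of_closed (P := fun y => zeroExt (innerVertices D) p.1 (Dart.vert y) =
      zeroExt (innerVertices D) p.1 (Dart.vert x)) (fun z hz => by rwa [Dart.vert_rot])
      (fun z hz => ?_) rfl y
    rw [h1, leftFace_opp, ← h1, ← hz, ← Dart.vert_rot ((Dart.rot C)⁻¹ z)]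
    simp
  exact ⟨h2, by rw [← h1, h2]⟩

variable [Fintype C]

theorem edgeCoboundary_orthogonal {D : Set (Dart C)} (hD : U.IsEdgeSet D) (h : U.edges D → ℚ)
    (p : (innerVertices D → ℚ) × (U.innerFaces D → ℚ)) :
    ∑ x, U.edgeCoboundary D h x * U.cellBoundary D p x = 0 := by
  have h1 := sum_sub_mul_vert (fun x => zeroExt (U.edges D) h (U.edge x))
    (zeroExt (innerVertices D) p.1)
  have h2 := U.sum_sub_mul_leftFace (fun x => zeroExt (U.edges D) h (U.edge x))
    (fun x => by rw [edge_opp]) (zeroExt (U.innerFaces D) p.2)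
  have h3 := sub_eq_zero.2 (h1.trans h2.symm)
  simp only [← Finset.sum_sub_distrib, ← mul_sub] at h3
  rw [← h3, ← Finset.sum_subset (Finset.subset_univ (Finset.univ.filter (· ∈ innerCorners D)))]
  · rw [← Finset.sum_subtype_of_mem (p := (· ∈ innerCorners D)) _ (by simp)]
    simp only [edgeCoboundary_apply, cellBoundary_apply]
    exact Finset.sum_congr (by ext; simp) fun _ _ => rfl
  · intro x _ hx
    have hx' : x ∉ innerCorners D := by simpa using hx
    rw [zeroExt_innerVertices hx', zeroExt_innerFaces hD hx', sub_zero, mul_zero]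

theorem card_edges_le {D : Set (Dart C)} (hc : U.CornerConnected D)
    (hne : D.Nonempty) :
    Fintype.card (U.edges D) ≤ Module.finrank ℚ (LinearMap.range (U.edgeCoboundary D)) + 1 := by
  have h1 := (U.edgeCoboundary D).finrank_range_add_finrank_ker
  rw [Module.finrank_pi] at h1
  have h2 : Module.finrank ℚ (LinearMap.ker (U.edgeCoboundary D)) ≤ 1 := by
    obtain ⟨x₀, hx₀⟩ := hne
    refine finrank_le_one ⟨fun _ => 1, ?_⟩ ?_
    · ext x
      rw [edgeCoboundary_apply, zeroExt_mem _ (U.edge_mem_edges x.2.1),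
        zeroExt_mem _ (U.edge_mem_edges x.2.2)]
      simp
    · rintro ⟨h, hh⟩
      refine ⟨h ⟨U.edge x₀, x₀, hx₀, rfl⟩, ?_⟩
      ext ⟨_, y, hy, rfl⟩
      have := hc (fun x => zeroExt (U.edges D) h (U.edge x₀) = zeroExt (U.edges D) h (U.edge x))
        (fun x _ hx => by rw [edge_opp]; exact hx) (fun x hx hx' => by
          have := congrFun hh ⟨x, hx, hx'⟩
          rw [edgeCoboundary_apply, Pi.zero_apply, sub_eq_zero] at this
          rw [this]) x₀ hx₀ rfl y hy
      rw [zeroExt_mem _ (U.edge_mem_edges hx₀), zeroExt_mem _ (U.edge_mem_edges hy)] at this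
      simpa using this
  omega

theorem card_inner_le {D : Set (Dart C)} (hD : U.IsEdgeSet D) (hne : D ≠ Set.univ) :
    Fintype.card (innerVertices D) + Fintype.card (U.innerFaces D) ≤
      Module.finrank ℚ (LinearMap.range (U.cellBoundary D)) := by
  have h1 := (U.cellBoundary D).finrank_range_add_finrank_ker
  rw [Module.finrank_prod, Module.finrank_pi, Module.finrank_pi] at h1
  have h2 : LinearMap.ker (U.cellBoundary D) = ⊥ := by
    rw [LinearMap.ker_eq_bot']
    intro p hp
    obtain ⟨x, hx⟩ := (Set.ne_univ_iff_exists_notMem _).1 hne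
    have h0 : zeroExt (innerVertices D) p.1 (Dart.vert x) = 0 :=
      zeroExt_notMem _ fun h => hx (h x rfl)
    ext ⟨v, hv⟩
    · obtain ⟨y, rfl⟩ := Dart.vert_surjective v
      have := (eq_of_cellBoundary_eq_zero hD hp x y).1
      rwa [zeroExt_mem _ hv, h0] at this
    · obtain ⟨y, rfl⟩ := U.leftFace_surjective v
      have := (eq_of_cellBoundary_eq_zero hD hp x y).2
      rwa [zeroExt_mem _ hv, h0] at this
  rw [h2, finrank_bot] at h1
  omega

/-- Inner vertices and faces of a connected proper edge set `D`, together with its edges, exceed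
its corners by at most one. This is the bound `χ ≤ 1` for the Euler characteristic of the region
formed by `D` and its inner vertices and faces. -/
theorem card_edges_add_card_inner_le {D : Set (Dart C)} (hD : U.IsEdgeSet D)
    (hc : U.CornerConnected D) (hne : D.Nonempty) (huniv : D ≠ Set.univ) :
    Fintype.card (U.edges D) + (Fintype.card (innerVertices D) + Fintype.card (U.innerFaces D)) ≤
      Fintype.card (innerCorners D) + 1 := by
  have h1 := card_edges_le hc hne
  have h2 := card_inner_le hD huniv
  have h3 := finrank_range_add_le_of_orthogonal (edgeCoboundary_orthogonal hD)
  omega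

variable (U)

/-- By Euler's formula the ranges of the two maps fill up the space of functions on corners. -/
theorem card_corners_le :
    Fintype.card (innerCorners (Set.univ : Set (Dart C))) ≤
      Module.finrank ℚ (LinearMap.range (U.edgeCoboundary Set.univ)) +
        Module.finrank ℚ (LinearMap.range (U.cellBoundary Set.univ)) := by
  have h1 := card_edges_le U.cornerConnected_univ ⟨Dart.tail, trivial⟩
  have h2 := (U.cellBoundary Set.univ).finrank_range_add_finrank_ker
  have hV : innerVertices (Set.univ : Set (Dart C)) = Set.univ := by
    simp [innerVertices]
  have hF : U.innerFaces Set.univ = Set.univ := by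
    simp [innerFaces]
  have hX : innerCorners (Set.univ : Set (Dart C)) = Set.univ := by
    simp [innerCorners]
  have h3 : Module.finrank ℚ (LinearMap.ker (U.cellBoundary Set.univ)) ≤ 1 := by
    refine finrank_le_one ⟨⟨fun _ => 1, fun _ => 1⟩, ?_⟩ ?_
    · ext x
      rw [cellBoundary_apply, zeroExt_mem _ (hV ▸ trivial), zeroExt_mem _ (hF ▸ trivial)]
      simp
    · rintro ⟨p, hp⟩
      refine ⟨zeroExt _ p.1 (Dart.vert (Dart.tail : Dart C)), ?_⟩
      ext ⟨v, hv⟩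
      · obtain ⟨y, rfl⟩ := Dart.vert_surjective v
        have := (eq_of_cellBoundary_eq_zero U.isEdgeSet_univ hp Dart.tail y).1
        rw [zeroExt_mem _ hv] at this
        simpa using this.symm
      · obtain ⟨y, rfl⟩ := U.leftFace_surjective v
        have := (eq_of_cellBoundary_eq_zero U.isEdgeSet_univ hp Dart.tail y).2
        rw [zeroExt_mem _ hv] at this
        simpa using this.symm
  have h4 := U.card_edges_univ
  rw [Module.finrank_prod, Module.finrank_pi, Module.finrank_pi] at h2
  have h5 : Fintype.card (innerVertices (Set.univ : Set (Dart C))) = Fintype.card C + 2 := by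
    rw [Fintype.card_congr ((Equiv.setCongr hV).trans (Equiv.Set.univ _))]; simp
  have h6 : Fintype.card (U.innerFaces Set.univ) = Fintype.card C + 1 := by
    rw [← U.card_face]
    exact Fintype.card_congr ((Equiv.setCongr hF).trans (Equiv.Set.univ _))
  have h7 : Fintype.card (innerCorners (Set.univ : Set (Dart C))) = 4 * Fintype.card C + 2 := by
    rw [← Dart.card_eq]
    exact Fintype.card_congr ((Equiv.setCongr hX).trans (Equiv.Set.univ _))
  omega

/-- On the sphere a function on corners is the coboundary of a height function on edges, if it is
orthogonal to all boundaries of vertices and faces. -/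
theorem exists_height (z : Dart C → ℚ)
    (hz : ∀ (a : C ⊕ Bool → ℚ) (b : U.Face → ℚ),
      ∑ x, z x * (a (Dart.vert x) - b (U.leftFace x)) = 0) :
    ∃ h : Dart C → ℚ, (∀ x, h (U.opp x) = h x) ∧ ∀ x, h (Dart.rot C x) - h x = z x := by
  have hX (x : Dart C) : x ∈ innerCorners (Set.univ : Set (Dart C)) := ⟨trivial, trivial⟩
  obtain ⟨h, hh⟩ := mem_range_of_orthogonal (edgeCoboundary_orthogonal U.isEdgeSet_univ)
    U.card_corners_le (z := fun x => z x) fun p => by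
      rw [← hz (zeroExt _ p.1) (zeroExt _ p.2)]
      refine Fintype.sum_equiv (Equiv.subtypeUnivEquiv hX) _ _ fun x => ?_
      rw [cellBoundary_apply]; rfl
  refine ⟨fun x => zeroExt _ h (U.edge x), fun x => by simp only [edge_opp], fun x => ?_⟩
  exact congrFun hh ⟨x, hX x⟩

/-- On the sphere a circulation `z` along corners has winding numbers `a` around the vertices and
`b` around the faces, whose difference at each corner is `z`. -/
theorem exists_winding (z : Dart C → ℚ)
    (hz : ∀ h : Dart C → ℚ, (∀ x, h (U.opp x) = h x) →
      ∑ x, z x * (h (Dart.rot C x) - h x) = 0) :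
    ∃ (a : C ⊕ Bool → ℚ) (b : U.Face → ℚ), ∀ x, a (Dart.vert x) - b (U.leftFace x) = z x := by
  have hX (x : Dart C) : x ∈ innerCorners (Set.univ : Set (Dart C)) := ⟨trivial, trivial⟩
  obtain ⟨p, hp⟩ := mem_range_of_orthogonal (d := U.cellBoundary Set.univ)
    (j := U.edgeCoboundary Set.univ)
    (fun p h => by simpa only [mul_comm] using edgeCoboundary_orthogonal U.isEdgeSet_univ h p)
    (by rw [add_comm]; exact U.card_corners_le) (z := fun x => z x) fun h => by
      rw [← hz (fun x => zeroExt _ h (U.edge x)) fun x => by simp only [edge_opp]]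
      refine Fintype.sum_equiv (Equiv.subtypeUnivEquiv hX) _ _ fun x => ?_
      rw [edgeCoboundary_apply]; rfl
  refine ⟨zeroExt _ p.1, zeroExt _ p.2, fun x => ?_⟩
  have := congrFun hp ⟨x, hX x⟩
  rwa [cellBoundary_apply] at this

end LinkoidUniverse

/-! ### Counting faces inside an edge set -/

namespace LinkoidUniverse

open scoped Classical

variable {C : Type*}

/-- The number of half-edges of `D` at the crossing `c`. -/
noncomputable def degIn (D : Set (Dart C)) (c : C) : ℕ :=
  ∑ i : ZMod 4, if Dart.cross c i ∈ D then 1 else 0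

/-- The number of inner corners of `D` at the crossing `c`. -/
noncomputable def cornersIn (D : Set (Dart C)) (c : C) : ℕ :=
  ∑ i : ZMod 4, if Dart.cross c i ∈ innerCorners D then 1 else 0

theorem sum_zmod_four {M : Type*} [AddCommMonoid M] (f : ZMod 4 → M) :
    ∑ i, f i = f 0 + f 1 + f 2 + f 3 := Fin.sum_univ_four f

theorem forall_zmod_four {p : ZMod 4 → Prop} : (∀ i, p i) ↔ p 0 ∧ p 1 ∧ p 2 ∧ p 3 :=
  ⟨fun h => ⟨h 0, h 1, h 2, h 3⟩, fun ⟨h0, h1, h2, h3⟩ i => by fin_cases i <;> assumption⟩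

theorem zmod_four_add_one :
    (0 : ZMod 4) + 1 = 1 ∧ (1 : ZMod 4) + 1 = 2 ∧ (2 : ZMod 4) + 1 = 3 ∧ (3 : ZMod 4) + 1 = 0 := by
  decide

theorem degIn_le_four (D : Set (Dart C)) (c : C) : degIn D c ≤ 4 := by
  rw [degIn, sum_zmod_four]
  split_ifs <;> decide

theorem mem_of_degIn_eq_four {D : Set (Dart C)} {c : C} (h : degIn D c = 4) (i : ZMod 4) :
    Dart.cross c i ∈ D := by
  revert i
  rw [forall_zmod_four]
  rw [degIn, sum_zmod_four] at h
  by_cases h0 : Dart.cross c 0 ∈ D <;> by_cases h1 : Dart.cross c 1 ∈ D <;>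
    by_cases h2 : Dart.cross c 2 ∈ D <;> by_cases h3 : Dart.cross c 3 ∈ D <;> simp_all

theorem notMem_of_degIn_eq_zero {D : Set (Dart C)} {c : C} (h : degIn D c = 0) (i : ZMod 4) :
    Dart.cross c i ∉ D := by
  simpa using (Finset.sum_eq_zero_iff.1 h) i (Finset.mem_univ i)

theorem degIn_eq_four_iff {D : Set (Dart C)} {c : C} :
    degIn D c = 4 ↔ Sum.inl c ∈ innerVertices D := by
  constructor
  · intro h x hx
    obtain ⟨i, rfl⟩ := Dart.vert_eq_inl hx
    exact mem_of_degIn_eq_four h i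
  · intro h
    have h' : ∀ i, Dart.cross c i ∈ D := fun i => h _ rfl
    simp [degIn, h', ZMod.card]

/-- At a crossing with some, but not all half-edges in `D`, the local contribution to the Euler
characteristic falls short of the bound `min d 2`, by at least `2` unless `d = 3`. -/
theorem two_mul_cornersIn_le (D : Set (Dart C)) (c : C) :
    2 * cornersIn D c + (if degIn D c = 3 then 1 else 0) +
        (if degIn D c = 1 ∨ degIn D c = 2 then 2 else 0) ≤
      min (degIn D c) 2 + degIn D c + 2 * (if degIn D c = 4 then 1 else 0) := by
  obtain ⟨e0, e1, e2, e3⟩ := zmod_four_add_one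
  simp only [cornersIn, degIn, sum_zmod_four, innerCorners, Set.mem_ofPred_eq, Dart.rot_cross,
    e0, e1, e2, e3]
  by_cases h0 : Dart.cross c 0 ∈ D <;> by_cases h1 : Dart.cross c 1 ∈ D <;>
    by_cases h2 : Dart.cross c 2 ∈ D <;> by_cases h3 : Dart.cross c 3 ∈ D <;> simp [*]

/-- Splitting an edge set into two parts without common corners. -/
theorem min_degIn_add_le {D D₁ D₂ : Set (Dart C)} (hD : D = D₁ ∪ D₂) (hdisj : Disjoint D₁ D₂)
    (h12 : ∀ x ∈ D₁, Dart.rot C x ∉ D₂) (h21 : ∀ x ∈ D₂, Dart.rot C x ∉ D₁) (c : C) :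
    min (degIn D₁ c) 2 + min (degIn D₂ c) 2 ≤ min (degIn D c) 2 := by
  obtain ⟨e0, e1, e2, e3⟩ := zmod_four_add_one
  subst hD
  rw [Set.disjoint_left] at hdisj
  have a0 := @hdisj (.cross c 0)
  have a1 := @hdisj (.cross c 1)
  have a2 := @hdisj (.cross c 2)
  have a3 := @hdisj (.cross c 3)
  have b0 := h12 (.cross c 0)
  have b1 := h12 (.cross c 1)
  have b2 := h12 (.cross c 2)
  have b3 := h12 (.cross c 3)
  have c0 := h21 (.cross c 0)
  have c1 := h21 (.cross c 1)
  have c2 := h21 (.cross c 2)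
  have c3 := h21 (.cross c 3)
  rw [Dart.rot_cross] at b0 b1 b2 b3 c0 c1 c2 c3
  rw [e0] at b0 c0
  rw [e1] at b1 c1
  rw [e2] at b2 c2
  rw [e3] at b3 c3
  simp only [degIn, sum_zmod_four, Set.mem_union]
  clear h12 h21 hdisj e0 e1 e2 e3
  by_cases p0 : Dart.cross c 0 ∈ D₁ <;> by_cases p1 : Dart.cross c 1 ∈ D₁ <;>
    by_cases p2 : Dart.cross c 2 ∈ D₁ <;> by_cases p3 : Dart.cross c 3 ∈ D₁ <;>
    simp_all only [true_imp_iff, false_imp_iff, not_true, not_false_iff, if_true, if_false,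
      true_or, false_or] <;>
    (try split_ifs) <;> first | omega | simp_all

variable [Fintype C] {U : LinkoidUniverse C}

/-- The number of ends of the linkoid whose half-edges lie in `D`. -/
noncomputable def endsIn (D : Set (Dart C)) : ℕ :=
  (if Dart.tail ∈ D then 1 else 0) + (if Dart.head ∈ D then 1 else 0)

theorem two_mul_card_edges_eq {D : Set (Dart C)} (hD : U.IsEdgeSet D) :
    2 * Fintype.card (U.edges D) = ∑ c, degIn D c + endsIn D := by
  rw [U.two_mul_card_edges D hD, Finset.card_filter, Dart.sum_eq]
  rfl

theorem card_innerCorners (D : Set (Dart C)) :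
    Fintype.card (innerCorners D) = ∑ c, cornersIn D c + endsIn D := by
  rw [Fintype.card_subtype, Finset.card_filter, Dart.sum_eq]
  simp [endsIn, cornersIn, innerCorners]

theorem card_innerVertices (D : Set (Dart C)) :
    Fintype.card (innerVertices D) = ∑ c, (if degIn D c = 4 then 1 else 0) + endsIn D := by
  rw [Fintype.card_subtype, Finset.card_filter, Fintype.sum_sum_type, Fintype.sum_bool, add_comm
    (if Sum.inr true ∈ _ then _ else _)]
  simp only [degIn_eq_four_iff, endsIn]
  have h1 : (Sum.inr false ∈ innerVertices D) ↔ Dart.tail ∈ D :=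
    ⟨fun h => h _ rfl, fun h x hx => by cases x <;> simp at hx; exact h⟩
  have h2 : (Sum.inr true ∈ innerVertices D) ↔ Dart.head ∈ D :=
    ⟨fun h => h _ rfl, fun h x hx => by cases x <;> simp at hx; exact h⟩
  simp only [h1, h2]

/-- The bound `χ ≤ 1` for a connected proper edge set, in terms of local data at the crossings. -/
theorem euler_inequality {D : Set (Dart C)} (hD : U.IsEdgeSet D)
    (hc : U.CornerConnected D) (hne : D.Nonempty) (huniv : D ≠ Set.univ) :
    ∑ c, (degIn D c + 2 * if degIn D c = 4 then 1 else 0) + endsIn D +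
        2 * Fintype.card (U.innerFaces D) ≤
      ∑ c, 2 * cornersIn D c + 2 := by
  have h1 := card_edges_add_card_inner_le hD hc hne huniv
  have h2 := two_mul_card_edges_eq hD
  rw [card_innerCorners, card_innerVertices] at h1
  rw [Finset.sum_add_distrib, ← Finset.mul_sum, ← Finset.mul_sum]
  omega

variable (U) in
/-- Some vertex is incident both to `D` and to its complement. -/
theorem exists_degIn_mixed {D : Set (Dart C)} (hD : U.IsEdgeSet D) (hne : D.Nonempty)
    (huniv : D ≠ Set.univ) : ∃ c, degIn D c ≠ 0 ∧ degIn D c ≠ 4 := by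
  by_contra! h
  obtain ⟨x, hx⟩ := hne
  refine huniv (Set.eq_univ_of_forall fun y => ?_)
  refine U.of_closed (P := (· ∈ D)) (fun z hz => ?_) hD hx y
  cases z with
  | cross c i =>
    exact mem_of_degIn_eq_four (h c fun h0 => notMem_of_degIn_eq_zero h0 i hz) _
  | tail => exact hz
  | head => exact hz

theorem two_mul_card_innerFaces_le_of_connected {D : Set (Dart C)} (hD : U.IsEdgeSet D)
    (hc : U.CornerConnected D) (hne : D.Nonempty) (huniv : D ≠ Set.univ) :
    2 * Fintype.card (U.innerFaces D) ≤ ∑ c, min (degIn D c) 2 := by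
  have h1 := euler_inequality hD hc hne huniv
  have h2 := Finset.sum_le_sum fun c (_ : c ∈ Finset.univ) => two_mul_cornersIn_le D c
  have h3 := two_mul_card_edges_eq hD
  obtain ⟨c, hc0, hc4⟩ := U.exists_degIn_mixed hD hne huniv
  simp only [Finset.sum_add_distrib, ← Finset.mul_sum] at h1 h2
  -- It remains to see that the local deficits and the ends add up to at least `2`.
  suffices 2 ≤ ∑ c, (if degIn D c = 3 then 1 else 0) +
      ∑ c, (if degIn D c = 1 ∨ degIn D c = 2 then 2 else 0) + endsIn D by omega
  by_cases h12 : ∃ c, degIn D c = 1 ∨ degIn D c = 2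
  · obtain ⟨b, hb⟩ := h12
    have := Finset.single_le_sum (f := fun c => if degIn D c = 1 ∨ degIn D c = 2 then 2 else 0)
      (fun _ _ => Nat.zero_le _) (Finset.mem_univ b)
    simp only [hb, if_true] at this
    omega
  · push Not at h12
    have hc3 : degIn D c = 3 := by
      have := degIn_le_four D c
      have := h12 c
      omega
    have h4 := Finset.single_le_sum (f := fun c => if degIn D c = 3 then 1 else 0)
      (fun _ _ => Nat.zero_le _) (Finset.mem_univ c)
    simp only [hc3, if_true] at h4
    have h5 : ∑ c, (if degIn D c = 3 then 1 else 0) ≡ ∑ c, degIn D c [MOD 2] := by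
      rw [Nat.ModEq, Finset.sum_nat_mod, Finset.sum_nat_mod (f := degIn D)]
      congr 1
      refine Finset.sum_congr rfl fun b _ => ?_
      have := degIn_le_four D b
      have := h12 b
      split_ifs <;> omega
    unfold Nat.ModEq at h5
    omega

theorem innerFaces_subset_union {D D₁ D₂ : Set (Dart C)} (hD : D = D₁ ∪ D₂)
    (h1 : U.IsEdgeSet D₁) (h2 : U.IsEdgeSet D₂)
    (h12 : ∀ x ∈ D₁, Dart.rot C x ∉ D₂) (h21 : ∀ x ∈ D₂, Dart.rot C x ∉ D₁) :
    U.innerFaces D ⊆ U.innerFaces D₁ ∪ U.innerFaces D₂ := by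
  subst hD
  have aux (A B : Set (Dart C)) (hA : U.IsEdgeSet A) (hBA : ∀ x ∈ B, Dart.rot C x ∉ A)
      (f : U.Face) (hf : f ∈ U.innerFaces (A ∪ B)) (x : Dart C) (hx : U.leftFace x = f)
      (hxA : x ∈ A) : f ∈ U.innerFaces A := by
    intro y hy
    refine (U.of_leftFace_eq (P := fun z => z ∈ A ∧ U.leftFace z = f) ?_ (hx.trans hy.symm)
      ⟨hxA, hx⟩).1
    rintro z ⟨hz, hzf⟩
    have hzf' := (U.leftFace_next z).trans hzf
    refine ⟨(hf _ hzf').resolve_right fun hB => hBA _ hB ?_, hzf'⟩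
    simpa using hA _ hz
  intro f hf
  obtain ⟨x, rfl⟩ := U.leftFace_surjective f
  rcases hf x rfl with hx | hx
  · exact Or.inl (aux D₁ D₂ h1 h21 _ hf x rfl hx)
  · exact Or.inr (aux D₂ D₁ h2 h12 _ (by rwa [Set.union_comm]) x rfl hx)

/-- The number of faces inside a proper edge set is bounded by its incidences with crossings. A
set that is not connected is split into two parts, and both sides of the bound are additive. -/
theorem two_mul_card_innerFaces_le {D : Set (Dart C)} (hD : U.IsEdgeSet D)
    (huniv : D ≠ Set.univ) :
    2 * Fintype.card (U.innerFaces D) ≤ ∑ c, min (degIn D c) 2 := by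
  induction hn : D.ncard using Nat.strong_induction_on generalizing D with
  | _ n ih =>
  subst hn
  by_cases hne : D.Nonempty
  swap
  · have : IsEmpty (U.innerFaces D) := ⟨fun ⟨f, hf⟩ => by
      obtain ⟨x, rfl⟩ := U.leftFace_surjective f
      exact hne ⟨x, hf x rfl⟩⟩
    simp
  by_cases hc : U.CornerConnected D
  · exact two_mul_card_innerFaces_le_of_connected hD hc hne huniv
  unfold CornerConnected at hc
  push Not at hc
  obtain ⟨P, hP, hP', x, hx, hPx, y, hy, hPy⟩ := hc
  have hP2 : ∀ x ∈ D, P (U.opp x) → P x := fun z hz h => by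
    simpa [U.opp_opp] using hP _ (hD _ hz) h
  have e : D = {z | z ∈ D ∧ P z} ∪ {z | z ∈ D ∧ ¬ P z} := by
    ext z
    by_cases h : P z <;> simp [h]
  have h1 : U.IsEdgeSet {z | z ∈ D ∧ P z} := fun z hz => ⟨hD _ hz.1, hP _ hz.1 hz.2⟩
  have h2 : U.IsEdgeSet {z | z ∈ D ∧ ¬ P z} := fun z hz => ⟨hD _ hz.1, fun h => hz.2 (hP2 _ hz.1 h)⟩
  have h12 : ∀ z ∈ {z | z ∈ D ∧ P z}, Dart.rot C z ∉ {z | z ∈ D ∧ ¬ P z} :=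
    fun z hz h => h.2 ((hP' z hz.1 h.1).1 hz.2)
  have h21 : ∀ z ∈ {z | z ∈ D ∧ ¬ P z}, Dart.rot C z ∉ {z | z ∈ D ∧ P z} :=
    fun z hz h => hz.2 ((hP' z hz.1 h.1).2 h.2)
  have hdisj : Disjoint {z | z ∈ D ∧ P z} {z | z ∈ D ∧ ¬ P z} :=
    Set.disjoint_left.2 fun z hz h => h.2 hz.2
  have i1 := ih _ (Set.ncard_lt_ncard ⟨fun z hz => hz.1, fun h => hPy (h hy).2⟩) h1
    (fun h => hPy (h.symm ▸ Set.mem_univ y : y ∈ {z | z ∈ D ∧ P z}).2) rfl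
  have i2 := ih _ (Set.ncard_lt_ncard ⟨fun z hz => hz.1, fun h => (h hx).2 hPx⟩) h2
    (fun h => (h.symm ▸ Set.mem_univ x : x ∈ {z | z ∈ D ∧ ¬ P z}).2 hPx) rfl
  have hF : Fintype.card (U.innerFaces D) ≤ Fintype.card (U.innerFaces {z | z ∈ D ∧ P z}) +
      Fintype.card (U.innerFaces {z | z ∈ D ∧ ¬ P z}) := by
    simp only [← Nat.card_eq_fintype_card, Nat.card_coe_set_eq]
    exact (Set.ncard_le_ncard (innerFaces_subset_union e h1 h2 h12 h21)).trans
      (Set.ncard_union_le _ _)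
  have hS := Finset.sum_le_sum fun c (_ : c ∈ Finset.univ) => min_degIn_add_le e hdisj h12 h21 c
  rw [Finset.sum_add_distrib] at hS
  omega

/-! ### Hall's condition and the existence of a clock state -/

variable (U)

/-- The faces that have a corner at one of the crossings in `T`. -/
noncomputable def facesAt (T : Finset C) : Finset U.Face :=
  Finset.univ.filter fun f => ∃ c ∈ T, ∃ i, U.cornerFace c i = f

/-- A nonempty set of crossings touches more faces than it has elements. -/
theorem card_lt_card_facesAt {T : Finset C} (hT : T.Nonempty) : T.card < (U.facesAt T).card := by
  let D : Set (Dart C) := {x | ∀ c ∈ T, Dart.vert x ≠ Sum.inl c ∧ Dart.vert (U.opp x) ≠ Sum.inl c}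
  have hD : U.IsEdgeSet D := fun x hx c hc => ⟨(hx c hc).2, by rw [U.opp_opp]; exact (hx c hc).1⟩
  have huniv : D ≠ Set.univ := by
    obtain ⟨c, hc⟩ := hT
    intro h
    exact ((h.symm ▸ Set.mem_univ (Dart.cross c 0) : Dart.cross c 0 ∈ D) c hc).1 rfl
  have h1 := two_mul_card_innerFaces_le hD huniv
  have h2 : ∑ c, min (degIn D c) 2 ≤ ∑ c, if c ∈ T then 0 else 2 := by
    refine Finset.sum_le_sum fun c _ => ?_
    split_ifs with hc
    · have : degIn D c = 0 := Finset.sum_eq_zero fun i _ => if_neg fun h => (h c hc).1 rfl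
      simp [this]
    · exact min_le_right _ _
  have h3 : ∑ c, (if c ∈ T then 0 else 2) = 2 * (Fintype.card C - T.card) := by
    rw [← Finset.card_compl, Finset.sum_ite, Finset.sum_const_zero, zero_add, Finset.sum_const,
      smul_eq_mul, mul_comm]
    congr 2
    ext; simp
  have h4 : (U.facesAt T)ᶜ.card ≤ Fintype.card (U.innerFaces D) := by
    rw [Fintype.card_subtype]
    refine Finset.card_le_card fun f hf => ?_
    simp only [facesAt, Finset.mem_compl, Finset.mem_filter, Finset.mem_univ, true_and] at hf ⊢
    intro x hx c hc
    constructor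
    · intro hv
      obtain ⟨i, rfl⟩ := Dart.vert_eq_inl hv
      exact hf ⟨c, hc, i, hx⟩
    · intro hv
      rw [← Dart.vert_rot, ← (Dart.rot C).apply_symm_apply (U.opp x), Dart.vert_rot,
        Dart.vert_rot] at hv
      obtain ⟨i, hi⟩ := Dart.vert_eq_inl hv
      refine hf ⟨c, hc, i, ?_⟩
      rw [cornerFace, ← hi, ← hx]
      exact U.leftFace_next x
  have h5 := Finset.card_le_univ T
  have h6 := Finset.card_le_univ (U.facesAt T)
  rw [Finset.card_compl, U.card_face] at h4
  rw [U.card_face] at h6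
  omega

/-- There are as many crossings as unstarred faces, so that an injective choice of unstarred
corners is a clock state. -/
theorem existsUnique_marker_of_injective {k : C → ZMod 4}
    (hk : ∀ c, U.cornerFace c (k c) ≠ U.star)
    (hinj : Function.Injective fun c => U.cornerFace c (k c)) (f : U.Face) (hf : f ≠ U.star) :
    ∃! c, U.cornerFace c (k c) = f := by
  have h1 : Finset.univ.image (fun c => U.cornerFace c (k c)) = Finset.univ.erase U.star := by
    refine Finset.eq_of_subset_of_card_le (fun f hf => ?_) ?_
    · obtain ⟨c, -, rfl⟩ := Finset.mem_image.1 hf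
      exact Finset.mem_erase.2 ⟨hk c, Finset.mem_univ _⟩
    · rw [Finset.card_image_of_injective _ hinj, Finset.card_erase_of_mem (Finset.mem_univ _),
        Finset.card_univ, Finset.card_univ, U.card_face, Nat.add_sub_cancel]
  obtain ⟨c, -, hc⟩ := Finset.mem_image.1 (h1 ▸ Finset.mem_erase.2 ⟨hf, Finset.mem_univ f⟩)
  exact ⟨c, hc, fun d hd => hinj (hd.trans hc.symm)⟩

/-- By Hall's marriage theorem clock states exist. -/
theorem nonempty_clockState : Nonempty U.ClockState := by
  let t (c : C) : Finset U.Face :=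
    Finset.univ.filter fun f => f ≠ U.star ∧ ∃ i, U.cornerFace c i = f
  obtain ⟨F, hF, hFt⟩ := (Finset.all_card_le_biUnion_card_iff_exists_injective t).1 fun T => by
    rcases T.eq_empty_or_nonempty with rfl | hT
    · simp
    have h1 := U.card_lt_card_facesAt hT
    have h2 : U.facesAt T ⊆ insert U.star (T.biUnion t) := by
      intro f hf
      obtain ⟨c, hc, hi⟩ := (Finset.mem_filter.1 hf).2
      by_cases hs : f = U.star
      · exact Finset.mem_insert.2 (Or.inl hs)
      · exact Finset.mem_insert_of_mem <| Finset.mem_biUnion.2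
          ⟨c, hc, Finset.mem_filter.2 ⟨Finset.mem_univ _, hs, hi⟩⟩
    have h3 := (Finset.card_le_card h2).trans (Finset.card_insert_le _ _)
    omega
  have h (c : C) := (Finset.mem_filter.1 (hFt c)).2
  choose hs k hk using h
  have hk' : (fun c => U.cornerFace c (k c)) = F := funext hk
  exact ⟨⟨k, fun c => hk c ▸ hs c, U.existsUnique_marker_of_injective (fun c => hk c ▸ hs c)
    (hk' ▸ hF)⟩⟩

end LinkoidUniverse

/-! ### Heights of clock states -/

namespace LinkoidUniverse

open scoped Classical

variable {C : Type*} {U : LinkoidUniverse C}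

/-- A height function that is constant around the corners of a face is constant on its edges. -/
theorem eq_of_leftFace_eq [Finite C] {α : Type*} {h : Dart C → α} (hopp : ∀ x, h (U.opp x) = h x)
    {f : U.Face} (hf : ∀ x, U.leftFace x = f → h (Dart.rot C x) = h x) {x y : Dart C}
    (hx : U.leftFace x = f) (hy : U.leftFace y = f) : h y = h x := by
  refine (U.of_leftFace_eq (P := fun z => h z = h x ∧ U.leftFace z = f) ?_ (hx.trans hy.symm)
    ⟨rfl, hx⟩).1
  rintro z ⟨hz, hzf⟩
  have hzf' := (U.leftFace_next z).trans hzf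
  refine ⟨?_, hzf'⟩
  rw [← hf _ hzf', ← hz, ← hopp z]
  simp

/-- Heights are determined by their differences at corners and by one value. -/
theorem height_unique {h g : Dart C → ℚ} (hh : ∀ x, h (U.opp x) = h x)
    (hg : ∀ x, g (U.opp x) = g x)
    (hd : ∀ x, h (Dart.rot C x) - h x = g (Dart.rot C x) - g x) {x : Dart C} (hx : h x = g x)
    (y : Dart C) : h y = g y :=
  U.of_closed (P := fun y => h y = g y) (fun z hz => by linarith [hd z])
    (fun z hz => by rw [hh, hg, hz]) hx y

theorem eq_of_zmod_four_step {α : Type*} {g : ZMod 4 → α} (h : ∀ k, g (k + 1) = g k)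
    (k : ZMod 4) : g k = g 0 := by
  have e0 := h 0
  have e1 := h 1
  have e2 := h 2
  rw [zmod_four_add_one.1] at e0
  rw [zmod_four_add_one.2.1] at e1
  rw [zmod_four_add_one.2.2.1] at e2
  revert k
  rw [forall_zmod_four]
  exact ⟨rfl, e0, e1.trans e0, e2.trans (e1.trans e0)⟩

namespace ClockState

/-- The indicator function of the markers of a clock state. -/
noncomputable def marker (s : U.ClockState) : Dart C → ℚ
  | .cross c i => if s.corner c = i then 1 else 0
  | _ => 0

@[simp] theorem marker_cross (s : U.ClockState) (c : C) (i : ZMod 4) :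
    s.marker (.cross c i) = if s.corner c = i then 1 else 0 := rfl
@[simp] theorem marker_tail (s : U.ClockState) : s.marker .tail = 0 := rfl
@[simp] theorem marker_head (s : U.ClockState) : s.marker .head = 0 := rfl

theorem cornerFace_injective (s : U.ClockState) :
    Function.Injective fun c => U.cornerFace c (s.corner c) := fun c _ h =>
  (s.existsUnique_marker _ (s.ne_star c)).unique rfl h.symm

variable [Fintype C]

theorem sum_marker_mul (s : U.ClockState) (g : Dart C → ℚ) :
    ∑ x, s.marker x * g x = ∑ c, g (.cross c (s.corner c)) := by
  simp [Dart.sum_eq]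

theorem sum_cornerFace (s : U.ClockState) (b : U.Face → ℚ) :
    ∑ c, b (U.cornerFace c (s.corner c)) = ∑ f ∈ Finset.univ.erase U.star, b f := by
  have : Finset.univ.erase U.star = Finset.univ.image fun c => U.cornerFace c (s.corner c) := by
    ext f
    simp only [Finset.mem_erase, Finset.mem_univ, and_true, Finset.mem_image, true_and]
    exact ⟨fun h => (s.existsUnique_marker f h).exists, fun ⟨c, hc⟩ => hc ▸ s.ne_star c⟩
  rw [this, Finset.sum_image fun c _ d _ h => s.cornerFace_injective h]

theorem exists_relHeight (s t : U.ClockState) :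
    ∃ h : Dart C → ℚ, (∀ x, h (U.opp x) = h x) ∧ h .tail = 0 ∧
      ∀ x, h (Dart.rot C x) - h x = t.marker x - s.marker x := by
  obtain ⟨h, h1, h2⟩ := U.exists_height (fun x => t.marker x - s.marker x) fun a b => by
    simp only [sub_mul, Finset.sum_sub_distrib, sum_marker_mul]
    simp only [Dart.vert_cross]
    have := (t.sum_cornerFace b).trans (s.sum_cornerFace b).symm
    unfold cornerFace at this
    rw [this, sub_self]
  exact ⟨fun x => h x - h .tail, fun x => by simp only [h1], sub_self _,
    fun x => by rw [← h2]; ring⟩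

/-- The height of `t` relative to `s`: the function on edges, zero at the tail, whose difference at
each corner is the number of markers of `t` minus the number of markers of `s`. -/
noncomputable def relHeight (s t : U.ClockState) : Dart C → ℚ := (exists_relHeight s t).choose

theorem relHeight_opp (s t : U.ClockState) (x : Dart C) :
    relHeight s t (U.opp x) = relHeight s t x := (exists_relHeight s t).choose_spec.1 x

theorem relHeight_tail (s t : U.ClockState) : relHeight s t .tail = 0 :=
  (exists_relHeight s t).choose_spec.2.1

theorem relHeight_rot (s t : U.ClockState) (x : Dart C) :
    relHeight s t (Dart.rot C x) - relHeight s t x = t.marker x - s.marker x :=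
  (exists_relHeight s t).choose_spec.2.2 x

theorem relHeight_add (s t u : U.ClockState) (x : Dart C) :
    relHeight s t x + relHeight t u x = relHeight s u x := by
  refine height_unique (h := fun x => relHeight s t x + relHeight t u x)
    (fun x => by simp only [relHeight_opp]) (relHeight_opp s u) (fun x => ?_)
    (x := Dart.tail) (by simp [relHeight_tail]) x
  linarith [relHeight_rot s t x, relHeight_rot t u x, relHeight_rot s u x]

theorem relHeight_self (s : U.ClockState) (x : Dart C) : relHeight s s x = 0 := by
  linarith [relHeight_add s s s x]

theorem eq_of_relHeight_eq_zero {s t : U.ClockState} (h : ∀ x, relHeight s t x = 0) : s = t := by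
  ext c
  have := relHeight_rot s t (.cross c (s.corner c))
  rw [h, h] at this
  by_contra hne
  simp [Ne.symm hne] at this

omit [Fintype C] in
theorem zmod_four_ne (i : ZMod 4) :
    i - 1 ≠ i ∧ i - 1 ≠ i + 1 ∧ i ≠ i + 1 ∧ i - 1 ≠ i + 2 ∧ i ≠ i + 2 ∧ i + 1 + 1 = i + 2 ∧
      i + 2 + 1 = i - 1 ∧ i - 1 + 1 = i := by
  revert i; decide

theorem zmod_four_cases (i k : ZMod 4) : k = i ∨ k = i + 1 ∨ k = i + 2 ∨ k = i - 1 := by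
  revert i k; decide

/-- Around a crossing whose marker rotates clockwise, the height increases by one more at the
half-edge that is crossed than at the other three. -/
theorem relHeight_of_clockwise {s t : U.ClockState} {c : C} (hc : t.corner c = s.corner c - 1)
    {k : ZMod 4} (hk : k ≠ s.corner c) :
    relHeight s t (.cross c k) = relHeight s t (.cross c (s.corner c)) - 1 := by
  obtain ⟨h1, h2, h3, h4, h5, h6, h7, h8⟩ := zmod_four_ne (s.corner c)
  have e1 := relHeight_rot s t (.cross c (s.corner c))
  have e2 := relHeight_rot s t (.cross c (s.corner c + 1))
  have e3 := relHeight_rot s t (.cross c (s.corner c + 2))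
  simp only [Dart.rot_cross, marker_cross, hc, h1, h2, h3, h4, h5, h6, h7, if_true, if_false]
    at e1 e2 e3
  rcases zmod_four_cases (s.corner c) k with rfl | rfl | rfl | rfl
  · exact absurd rfl hk
  all_goals linarith

theorem relHeight_of_corner_eq {s t : U.ClockState} {c : C} (hc : t.corner c = s.corner c)
    (k : ZMod 4) : relHeight s t (.cross c (k + 1)) = relHeight s t (.cross c k) := by
  have := relHeight_rot s t (.cross c k)
  simp only [Dart.rot_cross, marker_cross, hc, sub_self] at this
  linarith

/-- The crossings that touch a set of half-edges. -/
noncomputable def _root_.LinkoidUniverse.touching (L : Set (Dart C)) : Finset C :=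
  Finset.univ.filter fun c => ∃ k, Dart.cross c k ∈ L

theorem _root_.LinkoidUniverse.mem_touching {L : Set (Dart C)} {c : C} :
    c ∈ touching L ↔ ∃ k, Dart.cross c k ∈ L := by simp [touching]

/-- A double clockwise move does not lower any height. Otherwise let `L` be the set of edges of
minimal height. The crossings that touch `L` include both crossings of the move, and they only touch
faces that are marked from these same crossings, against Hall's condition. -/
theorem DoubleClockwise.relHeight_nonneg {s t : U.ClockState} (hm : DoubleClockwise s t)
    (x : Dart C) : 0 ≤ relHeight s t x := by
  obtain ⟨c, d, hcd, hc, hd, hcf, hdf, hb⟩ := hm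
  have hAB : U.cornerFace c (s.corner c) ≠ U.cornerFace d (s.corner d) :=
    fun h => hcd (s.cornerFace_injective h)
  rw [hc] at hcf
  rw [hd] at hdf
  have : Nonempty (Dart C) := ⟨.tail⟩
  obtain ⟨y, hy⟩ := Finite.exists_min (relHeight s t)
  by_contra hx
  have hym : relHeight s t y < 0 := (hy x).trans_lt (not_le.1 hx)
  -- The only corners with a difference of heights.
  have hflat (z : Dart C) (h1 : z ≠ .cross c (s.corner c)) (h2 : z ≠ .cross c (s.corner c - 1))
      (h3 : z ≠ .cross d (s.corner d)) (h4 : z ≠ .cross d (s.corner d - 1)) :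
      relHeight s t (Dart.rot C z) = relHeight s t z := by
    rw [← sub_eq_zero, relHeight_rot, sub_eq_zero]
    cases z with
    | tail => rfl
    | head => rfl
    | cross b k =>
      simp only [marker_cross]
      by_cases hbc : b = c
      · subst hbc
        rw [hc, if_neg fun h => h2 (by rw [h]), if_neg fun h => h1 (by rw [h])]
      by_cases hbd : b = d
      · subst hbd
        rw [hd, if_neg fun h => h4 (by rw [h]), if_neg fun h => h3 (by rw [h])]
      rw [hb b hbc hbd]
  let L : Set (Dart C) := {z | relHeight s t z = relHeight s t y}
  have hyL : y ∈ L := rfl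
  have hLopp : U.IsEdgeSet L := fun z hz => (relHeight_opp s t z).trans hz
  have htail : Dart.tail ∉ L := fun h => by
    have h' : relHeight s t .tail = relHeight s t y := h
    rw [relHeight_tail] at h'
    linarith
  have hLc : Dart.cross c (s.corner c) ∉ L := fun h => by
    have h' : relHeight s t (.cross c (s.corner c)) = relHeight s t y := h
    have := relHeight_of_clockwise hc (zmod_four_ne (s.corner c)).2.2.1.symm
    linarith [hy (.cross c (s.corner c + 1))]
  have hLd : Dart.cross d (s.corner d) ∉ L := fun h => by
    have h' : relHeight s t (.cross d (s.corner d)) = relHeight s t y := h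
    have := relHeight_of_clockwise hd (zmod_four_ne (s.corner d)).2.2.1.symm
    linarith [hy (.cross d (s.corner d + 1))]
  have hc3 {k l : ZMod 4} (hk : k ≠ s.corner c) (hl : l ≠ s.corner c)
      (h : Dart.cross c k ∈ L) : Dart.cross c l ∈ L :=
    ((relHeight_of_clockwise hc hl).trans (relHeight_of_clockwise hc hk).symm).trans h
  have hd3 {k l : ZMod 4} (hk : k ≠ s.corner d) (hl : l ≠ s.corner d)
      (h : Dart.cross d k ∈ L) : Dart.cross d l ∈ L :=
    ((relHeight_of_clockwise hd hl).trans (relHeight_of_clockwise hd hk).symm).trans h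
  -- The boundary of the first face enters `L` at one of the two crossings and leaves it at the
  -- other one.
  have hiff : Dart.cross c (s.corner c + 1) ∈ L ↔ Dart.cross d (s.corner d - 1) ∈ L := by
    have h := U.sum_sub_mul_leftFace (fun z => if z ∈ L then 1 else 0)
      (fun z => by simp only [hLopp.opp_mem_iff])
      (fun f => if f = U.cornerFace c (s.corner c) then 1 else 0)
    rw [← Finset.sum_subset (Finset.subset_univ
      {.cross c (s.corner c), .cross d (s.corner d - 1)}), Finset.sum_pair (by simp [hcd])] at h
    · rw [show U.leftFace (.cross d (s.corner d - 1)) = _ from hdf,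
        show U.leftFace (.cross c (s.corner c)) = U.cornerFace c (s.corner c) from rfl] at h
      simp only [Dart.rot_cross, sub_add_cancel, hLc, hLd, if_true, if_false] at h
      by_cases h1 : Dart.cross c (s.corner c + 1) ∈ L <;>
        by_cases h2 : Dart.cross d (s.corner d - 1) ∈ L <;> simp [h1, h2] at h ⊢
    · intro z _ hz
      simp only [Finset.mem_insert, Finset.mem_singleton, not_or] at hz
      by_cases h2 : z = .cross c (s.corner c - 1)
      · rw [h2, show U.leftFace (.cross c (s.corner c - 1)) = _ from hcf, if_neg hAB.symm, mul_zero]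
      by_cases h3 : z = .cross d (s.corner d)
      · rw [h3, if_neg (show ¬ U.leftFace (.cross d (s.corner d)) = _ from hAB.symm), mul_zero]
      simp only [L, Set.mem_ofPred_eq, hflat z hz.1 h2 h3 hz.2, sub_self, zero_mul]
  have hcL : Dart.cross c (s.corner c + 1) ∈ L := by
    by_contra hcL
    have hdL := fun h => hcL (hiff.2 h)
    refine htail (U.of_closed (P := (· ∈ L)) (fun z hz => ?_) hLopp hyL .tail)
    refine (hflat z ?_ ?_ ?_ ?_).trans hz
    · rintro rfl; exact hLc hz
    · rintro rfl; exact hcL (hc3 (zmod_four_ne _).1 (zmod_four_ne _).2.2.1.symm hz)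
    · rintro rfl; exact hLd hz
    · rintro rfl; exact hdL hz
  have hdL := hiff.1 hcL
  have hcT : c ∈ touching L := mem_touching.2 ⟨_, hcL⟩
  have hdT : d ∈ touching L := mem_touching.2 ⟨_, hdL⟩
  refine (U.card_lt_card_facesAt ⟨c, hcT⟩).not_ge
    ((Finset.card_le_card (t := (touching L).image fun b => U.cornerFace b (s.corner b))
      fun f hf => ?_).trans Finset.card_image_le)
  by_cases hfA : U.cornerFace c (s.corner c) = f
  · exact Finset.mem_image.2 ⟨c, hcT, hfA⟩
  by_cases hfB : U.cornerFace d (s.corner d) = f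
  · exact Finset.mem_image.2 ⟨d, hdT, hfB⟩
  -- A face that takes no part in the move lies inside `L`, hence so does its marker.
  have hconst {z w : Dart C} (hz : U.leftFace z = f) (hw : U.leftFace w = f) (hzL : z ∈ L) :
      w ∈ L := by
    refine (eq_of_leftFace_eq (relHeight_opp s t) (fun v hv => hflat v ?_ ?_ ?_ ?_) hz hw).trans hzL
    · rintro rfl; exact hfA hv
    · rintro rfl; exact hfB (hcf ▸ hv)
    · rintro rfl; exact hfB hv
    · rintro rfl; exact hfA (hdf ▸ hv)
  obtain ⟨b, hbT, k, hk⟩ := (Finset.mem_filter.1 hf).2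
  obtain ⟨l, hl⟩ := mem_touching.1 hbT
  have hbL : Dart.cross b k ∈ L := by
    by_cases hbc : b = c
    · subst hbc
      exact hc3 (zmod_four_ne _).2.2.1.symm (fun h => hfA (h ▸ hk)) hcL
    by_cases hbd : b = d
    · subst hbd
      exact hd3 (zmod_four_ne _).1 (fun h => hfB (h ▸ hk)) hdL
    have hstep := relHeight_of_corner_eq (hb b hbc hbd)
    have h0 := eq_of_zmod_four_step (g := fun k => relHeight s t (.cross b k)) hstep
    exact (h0 k).trans ((h0 l).symm.trans hl)
  have hfs : f ≠ U.star := fun h => htail (hconst hk h.symm hbL)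
  obtain ⟨e, he, -⟩ := s.existsUnique_marker f hfs
  exact Finset.mem_image.2
    ⟨e, mem_touching.2 ⟨_, hconst hk he hbL⟩, he⟩

/-- A single clockwise move raises the heights of the edges beyond the crossed strand by one, and
these do not include the edge of the tail. -/
theorem SingleClockwise.relHeight_nonneg {s t : U.ClockState} (hm : SingleClockwise s t)
    (x : Dart C) : 0 ≤ relHeight s t x := by
  obtain ⟨c, hlead, hc, -, hb⟩ := hm
  let a : Dart C := .cross c (s.corner c)
  -- `R` is what remains connected with the crossing when the strand is cut.
  let R : Set (Dart C) := {y | Relation.ReflTransGen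
    (fun p q => q = Dart.rot C p ∨ (q = U.opp p ∧ p ≠ a ∧ p ≠ U.opp a)) a y}
  have haR : a ∈ R := .refl
  have hhead : Dart.head ∉ R := hlead
  have hRrot {y : Dart C} (hy : y ∈ R) : Dart.rot C y ∈ R := .tail hy (Or.inl rfl)
  have hRopp {y : Dart C} (hy : y ∈ R) (h1 : y ≠ a) (h2 : y ≠ U.opp a) : U.opp y ∈ R :=
    .tail hy (Or.inr ⟨rfl, h1, h2⟩)
  have hoppa : U.opp a ∉ R := fun h => by
    refine hhead (U.of_closed (P := (· ∈ R)) (fun _ => hRrot) (fun y hy => ?_) haR _)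
    by_cases h1 : y = a
    · exact h1 ▸ h
    by_cases h2 : y = U.opp a
    · rw [h2, U.opp_opp]; exact haR
    exact hRopp hy h1 h2
  have hRrot' {y : Dart C} : Dart.rot C y ∈ R ↔ y ∈ R := by
    refine ⟨fun h => ?_, hRrot⟩
    cases y with
    | tail => exact h
    | head => exact h
    | cross b k =>
      have := hRrot (hRrot (hRrot h))
      simp only [Dart.rot_cross, add_assoc] at this
      rwa [show ∀ k : ZMod 4, k + (1 + (1 + (1 + 1))) = k by decide] at this
  let K : Set (Dart C) := {y | y ∉ R ∨ U.opp y ∉ R}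
  have hK : U.IsEdgeSet K := fun y hy => by
    show U.opp y ∉ R ∨ U.opp (U.opp y) ∉ R
    rw [U.opp_opp]
    exact Or.symm hy
  have hKiff (y : Dart C) : y ∈ K ↔ y ∉ R ∨ y = a := by
    constructor
    · rintro (h | h)
      · exact Or.inl h
      · by_contra! hn
        exact h (hRopp hn.1 hn.2 fun e => hoppa (e ▸ hn.1))
    · rintro (h | rfl)
      exacts [Or.inl h, Or.inr hoppa]
  have hRcross (b : C) (k : ZMod 4) : Dart.cross b k ∈ R ↔ Dart.cross b 0 ∈ R := by
    exact (eq_of_zmod_four_step (g := fun k => Dart.cross b k ∈ R)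
      (fun k => propext (hRrot' (y := .cross b k))) k).to_iff
  have hKc (k : ZMod 4) : Dart.cross c k ∈ K ↔ k = s.corner c := by
    rw [hKiff, hRcross, ← hRcross c (s.corner c)]
    simp [haR, a]
  have hdeg (b : C) : degIn K b ≡ (if b = c then 1 else 0) [MOD 2] := by
    split_ifs with hbc
    · subst hbc
      simp [degIn, hKc, Nat.ModEq]
    · have (k : ZMod 4) : Dart.cross b k ∈ K ↔ Dart.cross b 0 ∉ R := by
        rw [hKiff, hRcross]
        simp [a, hbc]
      by_cases h0 : Dart.cross b 0 ∈ R <;> simp [degIn, this, h0, ZMod.card, Nat.ModEq]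
  -- Counting half-edges modulo 2 shows that `K` contains only one of the two ends.
  have htail : Dart.tail ∉ K := fun htail => by
    have h1 := two_mul_card_edges_eq hK
    have h2 : ∑ b, degIn K b ≡ ∑ b, (if b = c then 1 else 0) [MOD 2] := by
      rw [Nat.ModEq, Finset.sum_nat_mod, Finset.sum_nat_mod (f := fun b => if b = c then 1 else 0)]
      congr 1
      exact Finset.sum_congr rfl fun b _ => hdeg b
    rw [Finset.sum_ite_eq' , if_pos (Finset.mem_univ _)] at h2
    rw [endsIn, if_pos htail, if_pos (show Dart.head ∈ K from Or.inl hhead)] at h1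
    unfold Nat.ModEq at h2
    omega
  have key := height_unique (g := fun y => if y ∈ K then (1 : ℚ) else 0) (relHeight_opp s t)
    (fun y => by simp only [hK.opp_mem_iff]) (fun y => ?_) (x := .tail)
    (by rw [relHeight_tail, if_neg htail]) x
  · rw [key]
    split_ifs <;> norm_num
  · rw [relHeight_rot]
    cases y with
    | tail => exact (sub_self _).trans (sub_self _).symm
    | head => exact (sub_self _).trans (sub_self _).symm
    | cross b k =>
      by_cases hbc : b = c
      · subst hbc
        simp only [Dart.rot_cross, hKc, marker_cross, hc, eq_comm (b := k), eq_sub_iff_add_eq]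
      · simp [hKiff, hRcross, hb b hbc, a, hbc]

theorem ClockwiseMove.relHeight_nonneg {s t : U.ClockState} (hm : ClockwiseMove s t) (x : Dart C) :
    0 ≤ relHeight s t x :=
  hm.elim (fun h => h.relHeight_nonneg x) fun h => h.relHeight_nonneg x

theorem ClockwiseMove.exists_relHeight_pos {s t : U.ClockState} (hm : ClockwiseMove s t) :
    ∃ x, 0 < relHeight s t x := by
  obtain ⟨c, hc⟩ : ∃ c, t.corner c = s.corner c - 1 := by
    rcases hm with ⟨c, d, -, h, -⟩ | ⟨c, -, h, -⟩ <;> exact ⟨c, h⟩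
  refine ⟨.cross c (s.corner c), ?_⟩
  have h1 := relHeight_of_clockwise hc (zmod_four_ne (s.corner c)).2.2.1.symm
  have h2 := hm.relHeight_nonneg (.cross c (s.corner c + 1))
  linarith

end ClockState

end LinkoidUniverse

/-! ### Blocks of edges that can be lowered -/

namespace LinkoidUniverse

open scoped Classical

variable {C : Type*} {U : LinkoidUniverse C}

/-- The part of the complement of `K` that is connected with the tail through corners. -/
inductive Exterior (U : LinkoidUniverse C) (K : Set (Dart C)) : Dart C → Prop
  | tail : Exterior U K .tail
  | opp {x} : Exterior U K x → Exterior U K (U.opp x)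
  | rot {x} : Exterior U K x → Dart.rot C x ∉ K → Exterior U K (Dart.rot C x)
  | rotInv {x} : Exterior U K (Dart.rot C x) → x ∉ K → Exterior U K x

theorem Exterior.notMem {K : Set (Dart C)} (hK : U.IsEdgeSet K) (ht : Dart.tail ∉ K) {x : Dart C}
    (hx : U.Exterior K x) : x ∉ K := by
  induction hx with
  | tail => exact ht
  | opp _ ih => rwa [hK.opp_mem_iff]
  | rot _ h _ => exact h
  | rotInv _ h _ => exact h

/-- The set `K` together with all parts of its complement that are separated from the tail. -/
def fill (U : LinkoidUniverse C) (K : Set (Dart C)) : Set (Dart C) := {x | ¬ U.Exterior K x}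

theorem isEdgeSet_fill (K : Set (Dart C)) : U.IsEdgeSet (U.fill K) := fun x hx h =>
  hx (by simpa [U.opp_opp] using h.opp)

theorem cornerConnected_compl_fill (K : Set (Dart C)) : U.CornerConnected (U.fill K)ᶜ := by
  intro P hP hP' x hx hPx y hy
  have key (z : Dart C) (hz : U.Exterior K z) : P z ↔ P .tail := by
    induction hz with
    | tail => rfl
    | @opp z hz ih =>
      rw [← ih]
      refine ⟨fun h => ?_, hP _ (not_not.2 hz)⟩
      simpa [U.opp_opp] using hP _ (not_not.2 hz.opp) h
    | @rot z hz h ih => rw [← ih, hP' z (not_not.2 hz) (not_not.2 (hz.rot h))]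
    | @rotInv z hz h ih => rw [← ih, hP' z (not_not.2 (hz.rotInv h)) (not_not.2 hz)]
  exact (key y (not_not.1 hy)).2 ((key x (not_not.1 hx)).1 hPx)

theorem exterior_of_notMem {K F : Set (Dart C)} (hKF : K ⊆ F) (ht : Dart.tail ∉ F)
    (hF : U.CornerConnected Fᶜ) {x : Dart C} (hx : x ∉ F) : U.Exterior K x :=
  hF (U.Exterior K) (fun _ _ h => h.opp)
    (fun _ h1 h2 => ⟨fun h => h.rot fun h' => h2 (hKF h'), fun h => h.rotInv fun h' => h1 (hKF h')⟩)
    .tail ht .tail x hx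

namespace ClockState

variable (s : U.ClockState)

/-- The edges in `F` can be lowered as far as a single crossing is concerned: unless the corner
between two consecutive half-edges has a marker, the second lies in `F` only if the first does. -/
def Lowerable (F : Set (Dart C)) : Prop :=
  ∀ c k, k ≠ s.corner c → Dart.cross c (k + 1) ∈ F → Dart.cross c k ∈ F

/-- A block is a nonempty set of edges whose heights can be lowered together, such that its
complement contains the edge of the tail and is connected through corners. -/
structure IsBlock (F : Set (Dart C)) : Prop where
  nonempty : F.Nonempty
  isEdgeSet : U.IsEdgeSet F
  tail_notMem : Dart.tail ∉ F
  lowerable : s.Lowerable F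
  compl_connected : U.CornerConnected Fᶜ

variable {s}

theorem isBlock_fill {K : Set (Dart C)} (hne : K.Nonempty) (hK : U.IsEdgeSet K)
    (ht : Dart.tail ∉ K) (hl : s.Lowerable K) : s.IsBlock (U.fill K) where
  nonempty := hne.mono fun _ hx h => h.notMem hK ht hx
  isEdgeSet := isEdgeSet_fill K
  tail_notMem h := h .tail
  lowerable c k hk h := by
    intro hx
    by_cases h' : Dart.cross c (k + 1) ∈ K
    · exact hx.notMem hK ht (hl c k hk h')
    · exact h (hx.rot h')
  compl_connected := cornerConnected_compl_fill K

theorem fill_eq_of_minimal {F K : Set (Dart C)} (hF : Minimal s.IsBlock F) (hKF : K ⊆ F)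
    (hne : K.Nonempty) (hK : U.IsEdgeSet K) (hl : s.Lowerable K) : U.fill K = F := by
  have h1 : U.fill K ⊆ F := fun x hx => by
    by_contra h
    exact hx (exterior_of_notMem hKF hF.prop.tail_notMem hF.prop.compl_connected h)
  exact h1.antisymm
    (hF.le_of_le (isBlock_fill hne hK (fun h => hF.prop.tail_notMem (hKF h)) hl) h1)

theorem cornerConnected_of_minimal {F : Set (Dart C)} (hF : Minimal s.IsBlock F) :
    U.CornerConnected F := by
  intro P hP hP' x hx hPx y hy
  by_contra hPy
  have hKF : {z | z ∈ F ∧ P z} ⊆ F := fun z hz => hz.1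
  have hfill := fill_eq_of_minimal hF hKF ⟨x, hx, hPx⟩
    (fun z hz => ⟨hF.prop.isEdgeSet _ hz.1, hP _ hz.1 hz.2⟩)
    (fun c k hk hz => by
      have := hF.prop.lowerable c k hk hz.1
      exact ⟨this, (hP' _ this hz.1).2 hz.2⟩)
  have key := U.of_closed (P := fun z => z ∈ F ∧ ¬ P z) (fun z hz => ?_) (fun z hz => ?_)
    ⟨hy, hPy⟩ .tail
  · exact hF.prop.tail_notMem key.1
  · by_cases h : Dart.rot C z ∈ F
    · exact ⟨h, fun h' => hz.2 ((hP' _ hz.1 h).2 h')⟩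
    · have := exterior_of_notMem hKF hF.prop.tail_notMem hF.prop.compl_connected h
      exact absurd (this.rotInv fun h' => hz.2 h'.2) (hfill.symm ▸ hz.1 : z ∈ U.fill _)
  · refine ⟨hF.prop.isEdgeSet _ hz.1, fun h => hz.2 ?_⟩
    simpa [U.opp_opp] using hP _ (hF.prop.isEdgeSet _ hz.1) h

variable (s) in
/-- A step along an edge, or around a vertex counterclockwise through a corner without marker. -/
def ArrowStep (p q : Dart C) : Prop :=
  q = U.opp p ∨ ∃ b k, k ≠ s.corner b ∧ p = .cross b k ∧ q = .cross b (k + 1)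

theorem mem_of_arrowStep {F : Set (Dart C)} (hE : U.IsEdgeSet F) (hl : s.Lowerable F)
    {y e : Dart C} (h : Relation.ReflTransGen s.ArrowStep y e) (he : e ∈ F) : y ∈ F := by
  induction h using Relation.ReflTransGen.head_induction_on with
  | refl => exact he
  | head h _ ih =>
    rcases h with rfl | ⟨b, k, hk, rfl, rfl⟩
    · exact hE.opp_mem_iff.1 ih
    · exact hl b k hk ih

variable [Fintype C]

/-- A walk along arrows defines a nonnegative flow on the corners without marker. -/
theorem exists_flow {F : Set (Dart C)} (hE : U.IsEdgeSet F) (hl : s.Lowerable F)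
    {y e : Dart C} (h : Relation.ReflTransGen s.ArrowStep y e) (he : e ∈ F) :
    ∃ Z : Dart C → ℚ, (∀ x, 0 ≤ Z x) ∧
      (∀ x, Z x ≠ 0 → ∃ b k, k ≠ s.corner b ∧ x = .cross b k ∧ x ∈ F ∧ Dart.rot C x ∈ F) ∧
      ∀ h : Dart C → ℚ, (∀ x, h (U.opp x) = h x) →
        ∑ x, Z x * (h (Dart.rot C x) - h x) = h e - h y := by
  induction h using Relation.ReflTransGen.head_induction_on with
  | refl => exact ⟨0, fun _ => le_rfl, fun _ h => absurd rfl h, fun h _ => by simp⟩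
  | @head p q h hq ih =>
    obtain ⟨Z, hZ, hZ', hZs⟩ := ih
    rcases h with rfl | ⟨b, k, hk, rfl, rfl⟩
    · exact ⟨Z, hZ, hZ', fun h hh => by rw [hZs h hh, hh]⟩
    · have hq' := mem_of_arrowStep hE hl hq he
      refine ⟨Z + Pi.single (.cross b k) 1, fun x => ?_, fun x hx => ?_, fun h hh => ?_⟩
      · refine add_nonneg (hZ x) ?_
        rw [Pi.single_apply]
        split_ifs <;> norm_num
      · by_cases hxb : x = .cross b k
        · exact ⟨b, k, hk, hxb, hxb ▸ hl b k hk hq', hxb ▸ hq'⟩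
        · exact hZ' x (by simpa [hxb] using hx)
      · simp only [Pi.add_apply, add_mul, Finset.sum_add_distrib, hZs h hh, Pi.single_apply,
          ite_mul, zero_mul, one_mul, Finset.sum_ite_eq', Finset.mem_univ, if_true, Dart.rot_cross]
        ring

/-- Winding numbers are minimal at the starred face, if they decrease from vertices to faces, and
do not change at markers. Otherwise the crossings of minimal winding number only touch faces that
are marked from these same crossings, against Hall's condition. -/
theorem star_le_winding (s : U.ClockState) {a : C ⊕ Bool → ℚ} {b : U.Face → ℚ}
    (hab : ∀ x, b (U.leftFace x) ≤ a (Dart.vert x))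
    (hs : ∀ c, a (Sum.inl c) = b (U.cornerFace c (s.corner c))) (f : U.Face) : b U.star ≤ b f := by
  have : Nonempty U.Face := ⟨U.star⟩
  obtain ⟨f₀, hf₀⟩ := Finite.exists_min b
  refine le_trans ?_ (hf₀ f)
  by_contra! hlt
  have hmark (g : U.Face) (hg : b g = b f₀) :
      ∃ c, U.cornerFace c (s.corner c) = g ∧ a (Sum.inl c) = b f₀ := by
    obtain ⟨c, hc, -⟩ := s.existsUnique_marker g fun h => by rw [← hg, h] at hlt; exact hlt.false
    exact ⟨c, hc, by rw [hs, hc, hg]⟩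
  obtain ⟨c₀, -, hc₀⟩ := hmark f₀ rfl
  let T : Finset C := Finset.univ.filter fun c => a (Sum.inl c) = b f₀
  have hT (c : C) : c ∈ T ↔ a (Sum.inl c) = b f₀ := by simp [T]
  refine (U.card_lt_card_facesAt (T := T) ⟨c₀, (hT _).2 hc₀⟩).not_ge
    ((Finset.card_le_card (t := T.image fun c => U.cornerFace c (s.corner c))
      fun g hg => ?_).trans Finset.card_image_le)
  obtain ⟨d, hd, k, rfl⟩ := (Finset.mem_filter.1 hg).2
  have h1 : b (U.cornerFace d k) ≤ a (Sum.inl d) := hab (.cross d k)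
  rw [(hT d).1 hd] at h1
  obtain ⟨c, hc, hc'⟩ := hmark _ (h1.antisymm (hf₀ _))
  exact Finset.mem_image.2 ⟨c, (hT c).2 hc', hc⟩

/-- At a crossing not inside a minimal block only the half-edge next to the marker can belong to the
block. If it contained two half-edges, then by minimality there would be a closed walk along arrows
inside the block, which winds positively around the crossing. The complement of the block, however,
joins the crossing with the tail, where the winding number is zero. -/
theorem notMem_of_minimal {F : Set (Dart C)} (hF : Minimal s.IsBlock F) {c : C}
    (hc : Dart.cross c (s.corner c) ∉ F) : Dart.cross c (s.corner c + 2) ∉ F := by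
  intro h2
  obtain ⟨-, e2, e3, e4, e5, e6, e7, e8⟩ := zmod_four_ne (s.corner c)
  have hE := hF.prop.isEdgeSet
  have hl := hF.prop.lowerable
  have h1 : Dart.cross c (s.corner c + 1) ∈ F := hl c _ e3.symm (by rwa [e6])
  let K : Set (Dart C) := {y | Relation.ReflTransGen s.ArrowStep y (.cross c (s.corner c + 1))}
  have hKF : K ⊆ F := fun y hy => mem_of_arrowStep hE hl hy h1
  have hKl : s.Lowerable K := fun b k hk h => .head (Or.inr ⟨b, k, hk, rfl, rfl⟩) h
  have hfill := fill_eq_of_minimal hF hKF ⟨_, .refl⟩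
    (fun y hy => .head (Or.inl (U.opp_opp y).symm) hy) hKl
  have h2K : Dart.cross c (s.corner c + 2) ∈ K := by
    by_contra hn2
    have hn3 : Dart.cross c (s.corner c - 1) ∉ K := fun h =>
      hn2 (hKl c _ e5.symm (by rwa [e7]))
    have x0 : U.Exterior K (.cross c (s.corner c)) :=
      exterior_of_notMem hKF hF.prop.tail_notMem hF.prop.compl_connected hc
    have x3 : U.Exterior K (.cross c (s.corner c - 1)) :=
      .rotInv (by rwa [Dart.rot_cross, e8]) hn3
    have x2 : U.Exterior K (.cross c (s.corner c + 2)) :=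
      .rotInv (by rwa [Dart.rot_cross, e7]) hn2
    exact absurd x2 (hfill.symm ▸ h2 : _ ∈ U.fill K)
  obtain ⟨Z, hZ, hZF, hZs⟩ := exists_flow hE hl h2K h1
  -- Close the walk by the arrow at `c`, and let `a`, `b` be the winding numbers.
  obtain ⟨a, b, hab⟩ := U.exists_winding (Z + Pi.single (.cross c (s.corner c + 1)) 1)
    fun h hh => by
      simp only [Pi.add_apply, add_mul, Finset.sum_add_distrib, hZs h hh, Pi.single_apply,
        ite_mul, zero_mul, one_mul, Finset.sum_ite_eq', Finset.mem_univ, if_true,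
        Dart.rot_cross, e6]
      ring
  have hflow (x : Dart C) (hx : ¬ (x ∈ F ∧ Dart.rot C x ∈ F)) :
      a (Dart.vert x) = b (U.leftFace x) := by
    rw [← sub_eq_zero, hab]
    have hne : x ≠ .cross c (s.corner c + 1) := by
      rintro rfl
      exact hx ⟨h1, by rwa [Dart.rot_cross, e6]⟩
    by_contra h
    obtain ⟨-, -, -, -, h'⟩ := hZF x (by simpa [hne] using h)
    exact hx h'
  have hstar := s.star_le_winding (a := a) (b := b)
    (fun x => by
      rw [← sub_nonneg, hab]
      refine add_nonneg (hZ x) ?_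
      rw [Pi.single_apply]
      split_ifs <;> norm_num)
    (fun d => by
      have h := hab (.cross d (s.corner d))
      have hZ0 : Z (.cross d (s.corner d)) = 0 := by
        by_contra hne
        obtain ⟨b', k, hk, hx, -⟩ := hZF _ hne
        cases hx
        exact hk rfl
      have hne : Dart.cross d (s.corner d) ≠ .cross c (s.corner c + 1) := by
        intro hx
        injection hx with hd hk
        subst hd
        exact e3 hk
      rw [Pi.add_apply, hZ0, Pi.single_apply, if_neg hne, add_zero, sub_eq_zero] at h
      exact h)
  have hcompl := hF.prop.compl_connected (fun y => a (Dart.vert y) = b U.star)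
    (fun y hy h => by
      show a (Dart.vert (U.opp y)) = _
      rw [hflow _ fun h' => hE.compl y hy h'.1, leftFace_opp, ← hflow, ← Dart.vert_rot]
      · simpa using h
      · intro h'
        refine hy ?_
        simpa using h'.2)
    (fun y _ _ => by simp only [Dart.vert_rot]) .tail hF.prop.tail_notMem
    (hflow _ fun h => hF.prop.tail_notMem h.1) _ hc
  have hlast := hab (.cross c (s.corner c + 1))
  rw [Pi.add_apply, Pi.single_eq_same] at hlast
  have := hstar (U.leftFace (.cross c (s.corner c + 1)))
  have := hZ (.cross c (s.corner c + 1))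
  simp only [Dart.vert_cross] at hcompl hlast
  linarith

theorem cross_mem_of_minimal {F : Set (Dart C)} (hF : Minimal s.IsBlock F) (c : C) :
    (∀ k, Dart.cross c k ∈ F) ∨ (∀ k, Dart.cross c k ∉ F) ∨
      ∀ k, Dart.cross c k ∈ F ↔ k = s.corner c + 1 := by
  obtain ⟨-, e2, e3, e4, e5, e6, e7, e8⟩ := zmod_four_ne (s.corner c)
  have hl := hF.prop.lowerable c
  have l1 := hl (s.corner c + 1) e3.symm
  have l2 := hl (s.corner c + 2) e5.symm
  have l3 := hl (s.corner c - 1) (zmod_four_ne _).1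
  rw [e6] at l1
  rw [e7] at l2
  rw [e8] at l3
  by_cases h0 : Dart.cross c (s.corner c) ∈ F
  · left
    intro k
    rcases zmod_four_cases (s.corner c) k with rfl | rfl | rfl | rfl
    exacts [h0, l1 (l2 (l3 h0)), l2 (l3 h0), l3 h0]
  · have h2 := notMem_of_minimal hF h0
    have h3 := fun h => h2 (l2 h)
    right
    by_cases h1 : Dart.cross c (s.corner c + 1) ∈ F
    · right
      intro k
      rcases zmod_four_cases (s.corner c) k with rfl | rfl | rfl | rfl
      · exact ⟨fun h => absurd h h0, fun h => absurd h e3⟩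
      · exact ⟨fun _ => rfl, fun _ => h1⟩
      · exact ⟨fun h => absurd h h2, fun h => absurd h (by simp; decide)⟩
      · exact ⟨fun h => absurd h h3, fun h => absurd h e2⟩
    · left
      intro k
      rcases zmod_four_cases (s.corner c) k with rfl | rfl | rfl | rfl <;> assumption

/-- The crossings at the boundary of a block. -/
noncomputable def boundary (F : Set (Dart C)) : Finset C :=
  Finset.univ.filter fun c => degIn F c = 1

/-- If all half-edges at a crossing lie in a lowerable set, then so does the face that is marked
there: along this face, membership in the set can only get lost. -/
theorem cornerFace_mem_innerFaces {F : Set (Dart C)} (hE : U.IsEdgeSet F) (hl : s.Lowerable F)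
    {c : C} (hc : ∀ k, Dart.cross c k ∈ F) :
    U.cornerFace c (s.corner c) ∈ U.innerFaces F := by
  have hsum := U.sum_sub_mul_leftFace (fun x => if x ∈ F then 1 else 0)
    (fun x => by simp only [hE.opp_mem_iff])
    (fun f => if f = U.cornerFace c (s.corner c) then 1 else 0)
  rw [Finset.sum_eq_zero_iff_of_nonpos fun x _ => ?_] at hsum
  · intro y hy
    have := eq_of_leftFace_eq (h := fun x => if x ∈ F then (1 : ℚ) else 0)
      (f := U.cornerFace c (s.corner c)) (fun x => by simp only [hE.opp_mem_iff])
      (fun x hx => by simpa [hx, sub_eq_zero] using hsum x (Finset.mem_univ x))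
      (x := .cross c (s.corner c)) rfl hy
    simpa [hc] using this
  · by_cases hx : U.leftFace x = U.cornerFace c (s.corner c)
    swap
    · rw [if_neg hx, mul_zero]
    rw [if_pos hx, mul_one]
    cases x with
    | tail => exact (sub_self _).le
    | head => exact (sub_self _).le
    | cross b k =>
      by_cases hk : k = s.corner b
      · subst hk
        have : b = c := s.cornerFace_injective hx
        subst this
        simp [hc]
      · have := hl b k hk
        by_cases h1 : Dart.cross b (k + 1) ∈ F
        · simp [h1, this h1]
        · simp only [Dart.rot_cross, h1, if_false]
          split_ifs <;> norm_num

/-- By Euler's formula a minimal block has either two crossings at its boundary and does not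
contain the head, or one crossing at its boundary and contains the head. -/
theorem card_boundary_of_minimal {F : Set (Dart C)} (hF : Minimal s.IsBlock F) :
    ((boundary F).card = 2 ∧ Dart.head ∉ F) ∨ ((boundary F).card = 1 ∧ Dart.head ∈ F) := by
  have hE := hF.prop.isEdgeSet
  have huniv : F ≠ Set.univ := fun h => hF.prop.tail_notMem (h ▸ trivial)
  have h1 := euler_inequality hE (cornerConnected_of_minimal hF) hF.prop.nonempty huniv
  have h2 := two_mul_card_edges_eq hE
  obtain ⟨c₀, h0, h4⟩ := U.exists_degIn_mixed hE hF.prop.nonempty huniv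
  have hdeg (c : C) : (degIn F c = 4 ∧ cornersIn F c = 4) ∨ (degIn F c = 0 ∧ cornersIn F c = 0) ∨
      (degIn F c = 1 ∧ cornersIn F c = 0) := by
    rcases cross_mem_of_minimal hF c with h | h | h
    · left
      simp [degIn, cornersIn, innerCorners, h, ZMod.card]
    · right; left
      simp [degIn, cornersIn, innerCorners, h]
    · right; right
      have (k : ZMod 4) : ¬ (k = s.corner c + 1 ∧ k = s.corner c) := by
        rintro ⟨h1, h2⟩
        exact (zmod_four_ne (s.corner c)).2.2.1 (h2.symm.trans h1)
      simp [degIn, cornersIn, innerCorners, h, this]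
  have hn4 : (Finset.univ.filter fun c => degIn F c = 4).card ≤
      Fintype.card (U.innerFaces F) := by
    rw [Fintype.card_subtype]
    refine Finset.card_le_card_of_injOn (fun c => U.cornerFace c (s.corner c)) (fun c hc => ?_)
      (s.cornerFace_injective.injOn)
    simp only [Finset.coe_filter, Finset.mem_univ, true_and, Set.mem_ofPred_eq] at hc ⊢
    exact cornerFace_mem_innerFaces hE hF.prop.lowerable (mem_of_degIn_eq_four hc)
  have e1 : ∑ c, (degIn F c + 2 * if degIn F c = 4 then 1 else 0) =
      6 * (Finset.univ.filter fun c => degIn F c = 4).card + (boundary F).card := by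
    rw [boundary, Finset.card_filter, Finset.card_filter, Finset.mul_sum, ← Finset.sum_add_distrib]
    refine Finset.sum_congr rfl fun c _ => ?_
    rcases hdeg c with h | h | h <;> simp [h]
  have e2 : ∑ c, 2 * cornersIn F c = 8 * (Finset.univ.filter fun c => degIn F c = 4).card := by
    rw [Finset.card_filter, Finset.mul_sum]
    refine Finset.sum_congr rfl fun c _ => ?_
    rcases hdeg c with h | h | h <;> simp [h]
  have e3 : ∑ c, degIn F c =
      4 * (Finset.univ.filter fun c => degIn F c = 4).card + (boundary F).card := by
    rw [boundary, Finset.card_filter, Finset.card_filter, Finset.mul_sum, ← Finset.sum_add_distrib]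
    refine Finset.sum_congr rfl fun c _ => ?_
    rcases hdeg c with h | h | h <;> simp [h]
  have hpos : 0 < (boundary F).card := Finset.card_pos.2
    ⟨c₀, by
      have := hdeg c₀
      simp only [boundary, Finset.mem_filter, Finset.mem_univ, true_and]
      omega⟩
  rw [e1, e2] at h1
  rw [e3] at h2
  unfold endsIn at h1 h2
  rw [if_neg hF.prop.tail_notMem] at h1 h2
  by_cases hh : Dart.head ∈ F
  · rw [if_pos hh] at h1 h2
    right
    exact ⟨by omega, hh⟩
  · rw [if_neg hh] at h1 h2
    left
    exact ⟨by omega, hh⟩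

theorem cross_mem_iff_of_mem_boundary {F : Set (Dart C)} (hF : Minimal s.IsBlock F) {c : C}
    (hc : c ∈ boundary F) (k : ZMod 4) : Dart.cross c k ∈ F ↔ k = s.corner c + 1 := by
  have hd : degIn F c = 1 := (Finset.mem_filter.1 hc).2
  rcases cross_mem_of_minimal hF c with h | h | h
  · simp [degIn, h, ZMod.card] at hd
  · simp [degIn, h] at hd
  · exact h k

theorem rot_mem_iff_of_notMem_boundary {F : Set (Dart C)} (hF : Minimal s.IsBlock F) {c : C}
    (hc : c ∉ boundary F) (k : ZMod 4) : Dart.cross c (k + 1) ∈ F ↔ Dart.cross c k ∈ F := by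
  rcases cross_mem_of_minimal hF c with h | h | h
  · simp [h]
  · simp [h]
  · refine absurd (Finset.mem_filter.2 ⟨Finset.mem_univ _, ?_⟩) hc
    rw [degIn, Finset.sum_eq_single (s.corner c + 1) (fun k _ hk => if_neg ((h k).not.2 hk))
      (by simp), if_pos ((h _).2 rfl)]

/-- The faces from which the markers at the boundary are taken are those to which they go. -/
theorem sum_boundary {F : Set (Dart C)} (hF : Minimal s.IsBlock F) (b : U.Face → ℚ) :
    ∑ c ∈ boundary F, b (U.cornerFace c (s.corner c)) =
      ∑ c ∈ boundary F, b (U.cornerFace c (s.corner c + 1)) := by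
  have h := U.sum_sub_mul_leftFace (fun x => if x ∈ F then 1 else 0)
    (fun x => by simp only [hF.prop.isEdgeSet.opp_mem_iff]) b
  rw [Dart.sum_eq, Dart.rot_tail, Dart.rot_head, sub_self, sub_self, zero_mul, zero_mul, add_zero,
    add_zero, ← Finset.sum_subset (Finset.subset_univ (boundary F))] at h
  · rw [← sub_eq_zero, ← Finset.sum_sub_distrib, ← h]
    refine Finset.sum_congr rfl fun c hc => ?_
    simp [cross_mem_iff_of_mem_boundary hF hc, sub_mul, Finset.sum_sub_distrib, cornerFace]
  · intro c _ hc
    refine Finset.sum_eq_zero fun k _ => ?_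
    simp only [Dart.rot_cross, rot_mem_iff_of_notMem_boundary hF hc, sub_self, zero_mul]

/-- Corners whose faces are a permutation of the marked faces form a clock state. -/
theorem exists_corner_eq (s : U.ClockState) (k : C → ZMod 4) (σ : Equiv.Perm C)
    (h : ∀ c, U.cornerFace c (k c) = U.cornerFace (σ c) (s.corner (σ c))) :
    ∃ t : U.ClockState, t.corner = k := by
  have hs : ∀ c, U.cornerFace c (k c) ≠ U.star := fun c => h c ▸ s.ne_star _
  refine ⟨⟨k, hs, U.existsUnique_marker_of_injective hs fun c d hcd => ?_⟩, rfl⟩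
  simp only [h] at hcd
  exact σ.injective (s.cornerFace_injective hcd)

/-- If the boundary of a minimal block consists of two crossings, then none of their markers
can stay in its face. Otherwise it could be rotated alone. The resulting change of height would be
constant inside and outside the block; at the one crossing the two constants differ, at the other
one they agree. -/
theorem cornerFace_ne_of_minimal {F : Set (Dart C)} (hF : Minimal s.IsBlock F) {c d : C}
    (hcd : c ≠ d) (hb : boundary F = {c, d}) :
    U.cornerFace c (s.corner c) ≠ U.cornerFace c (s.corner c + 1) := by
  intro hface
  have hcF := cross_mem_iff_of_mem_boundary hF (c := c) (by simp [hb])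
  have hdF := cross_mem_iff_of_mem_boundary hF (c := d) (by simp [hb])
  have e3 (i : ZMod 4) : i ≠ i + 1 := (zmod_four_ne i).2.2.1
  obtain ⟨g, hg, hgz⟩ := U.exists_height
    (Pi.single (.cross c (s.corner c)) 1 - Pi.single (.cross c (s.corner c + 1)) 1) fun a b => by
      simp only [Pi.sub_apply, sub_mul, Finset.sum_sub_distrib, Pi.single_apply, ite_mul, one_mul,
        zero_mul, Finset.sum_ite_eq', Finset.mem_univ, if_true, Dart.vert_cross]
      unfold cornerFace at hface
      rw [hface]
      ring
  have hstep (x : Dart C) (h1 : x ≠ .cross c (s.corner c)) (h2 : x ≠ .cross c (s.corner c + 1)) :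
      g (Dart.rot C x) = g x := by
    rw [← sub_eq_zero, hgz]
    simp [h1, h2]
  have hin : g (.cross d (s.corner d + 1)) = g (.cross c (s.corner c + 1)) := by
    refine cornerConnected_of_minimal hF (fun x => g x = g (.cross c (s.corner c + 1)))
      (fun x _ h => by rwa [hg]) (fun x h1 h2 => ?_) _ ((hcF _).2 rfl) rfl _ ((hdF _).2 rfl)
    rw [hstep x]
    · rintro rfl
      exact e3 _ ((hcF _).1 h1)
    · rintro rfl
      rw [Dart.rot_cross, hcF] at h2
      exact e3 _ h2.symm
  have hout : g (.cross d (s.corner d)) = g (.cross c (s.corner c)) := by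
    refine hF.prop.compl_connected (fun x => g x = g (.cross c (s.corner c)))
      (fun x _ h => by rwa [hg]) (fun x h1 h2 => ?_) _ (fun h => e3 _ ((hcF _).1 h)) rfl _
      (fun h => e3 _ ((hdF _).1 h))
    rw [hstep x]
    · rintro rfl
      exact h2 ((hcF _).2 rfl)
    · rintro rfl
      exact h1 ((hcF _).2 rfl)
  have h1 := hgz (.cross c (s.corner c))
  have h2 := hstep (.cross d (s.corner d)) (by simp [hcd.symm]) (by simp [hcd.symm])
  rw [Dart.rot_cross] at h1 h2
  simp only [Pi.sub_apply, Pi.single_apply, if_true] at h1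
  rw [if_neg fun h => e3 _ (by injection h)] at h1
  linarith

/-- A block can be lowered: if it is minimal, then this is a counterclockwise clock move. -/
theorem exists_clockwiseMove_of_isBlock (hs : ∃ F, s.IsBlock F) :
    ∃ t : U.ClockState, ClockwiseMove t s := by
  obtain ⟨F, hF⟩ : ∃ F, Minimal s.IsBlock F := by
    obtain ⟨F, hF⟩ := (Set.toFinite {F | s.IsBlock F}).exists_minimal hs
    exact ⟨F, hF⟩
  have hE := hF.prop.isEdgeSet
  rcases card_boundary_of_minimal hF with ⟨h2, -⟩ | ⟨h1, hhead⟩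
  · obtain ⟨c, d, hcd, hb⟩ := Finset.card_eq_two.1 h2
    have hsum := sum_boundary hF
    simp only [hb, Finset.sum_pair hcd] at hsum
    have hne := cornerFace_ne_of_minimal hF hcd hb
    have hcA : U.cornerFace d (s.corner d + 1) = U.cornerFace c (s.corner c) := by
      by_contra h
      have := hsum fun f => if f = U.cornerFace c (s.corner c) then 1 else 0
      simp only [if_true, hne.symm, h, if_false] at this
      split_ifs at this <;> norm_num at this
    have hdB : U.cornerFace c (s.corner c + 1) = U.cornerFace d (s.corner d) := by
      by_contra h
      have := hsum fun f => if f = U.cornerFace d (s.corner d) then 1 else 0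
      rw [hcA, add_comm] at this
      simp [h] at this
    obtain ⟨t, ht⟩ := s.exists_corner_eq
      (fun b => if b = c ∨ b = d then s.corner b + 1 else s.corner b) (Equiv.swap c d) fun b => by
        by_cases hbc : b = c
        · subst hbc
          simp [hdB]
        by_cases hbd : b = d
        · subst hbd
          simp [hcA]
        · simp [hbc, hbd, Equiv.swap_apply_of_ne_of_ne]
    refine ⟨t, Or.inl ⟨c, d, hcd, ?_, ?_, ?_, ?_, fun b hbc hbd => ?_⟩⟩ <;>
      simp [*]
  · obtain ⟨c, hb⟩ := Finset.card_eq_one.1 h1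
    have hsum := sum_boundary hF
    simp only [hb, Finset.sum_singleton] at hsum
    have hface : U.cornerFace c (s.corner c + 1) = U.cornerFace c (s.corner c) := by
      have := hsum fun f => if f = U.cornerFace c (s.corner c) then 1 else 0
      by_contra h
      simp [h] at this
    obtain ⟨t, ht⟩ := s.exists_corner_eq
      (fun b => if b = c then s.corner b + 1 else s.corner b) 1 fun b => by
        by_cases hbc : b = c
        · subst hbc
          simp [hface]
        · simp [hbc]
    refine ⟨t, Or.inr ⟨c, ?_, by simp [ht], by simp [ht, hface], fun b hbc => by simp [ht, hbc]⟩⟩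
    have htc : t.corner c = s.corner c + 1 := by simp [ht]
    have hcF := cross_mem_iff_of_mem_boundary hF (c := c) (by simp [hb])
    rw [htc]
    -- Outside the cut strand, one cannot get from the crossing into the block.
    intro hpath
    have key (y : Dart C) (hy : Relation.ReflTransGen (fun p q => q = Dart.rot C p ∨
        (q = U.opp p ∧ p ≠ .cross c (s.corner c + 1) ∧ p ≠ U.opp (.cross c (s.corner c + 1))))
        (.cross c (s.corner c + 1)) y) : y ∉ F ∨ y = Dart.cross c (s.corner c + 1) := by
      induction hy with
      | refl => exact Or.inr rfl
      | @tail y z _ hz ih =>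
        rcases hz with rfl | ⟨rfl, hne, -⟩
        · rcases ih with h | rfl
          · cases y with
            | tail => exact Or.inl h
            | head => exact Or.inl h
            | cross b k =>
              by_cases hbc : b = c
              · subst hbc
                rw [Dart.rot_cross, hcF]
                by_cases hk : k + 1 = s.corner b + 1
                · exact Or.inr (by rw [hk])
                · exact Or.inl hk
              · left
                rwa [Dart.rot_cross, rot_mem_iff_of_notMem_boundary hF (by simpa [hb] using hbc)]
          · left
            rw [Dart.rot_cross, hcF]
            exact (zmod_four_ne _).2.2.1.symm
        · exact Or.inl (by rw [hE.opp_mem_iff]; exact ih.resolve_right hne)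
    rcases key _ hpath with h | h
    · exact h hhead
    · cases h

/-- A state that is somewhere higher than another state admits a counterclockwise clock move. -/
theorem exists_clockwiseMove_of_relHeight_pos {t : U.ClockState} {x : Dart C}
    (hx : 0 < relHeight t s x) : ∃ u : U.ClockState, ClockwiseMove u s := by
  refine exists_clockwiseMove_of_isBlock ⟨_, isBlock_fill (K := {y | 0 < relHeight t s y}) ⟨x, hx⟩
    (fun y hy => ?_) (fun h => ?_) fun c k hk h => ?_⟩
  · rwa [Set.mem_ofPred_eq, relHeight_opp]
  · rw [Set.mem_ofPred_eq, relHeight_tail] at h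
    exact h.false
  · have := relHeight_rot t s (.cross c k)
    rw [marker_cross, marker_cross, if_neg (Ne.symm hk), Dart.rot_cross] at this
    simp only [Set.mem_ofPred_eq] at h ⊢
    split_ifs at this <;> linarith

end ClockState

end LinkoidUniverse

/-! ### The clocked state -/

namespace LinkoidUniverse.ClockState

variable {C : Type*} {U : LinkoidUniverse C}

instance [Finite C] : Finite U.ClockState :=
  Finite.of_injective corner fun _ _ h => ClockState.ext h

variable [Fintype C]

theorem eq_of_isClocked {s t : U.ClockState} (hs : s.IsClocked) (ht : t.IsClocked) : s = t := by
  refine eq_of_relHeight_eq_zero fun x => ?_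
  rcases lt_trichotomy (relHeight s t x) 0 with h | h | h
  · have h' : 0 < relHeight t s x := by linarith [relHeight_add s t s x, relHeight_self s x]
    obtain ⟨u, hu⟩ := exists_clockwiseMove_of_relHeight_pos h'
    exact absurd hu (hs u)
  · exact h
  · obtain ⟨u, hu⟩ := exists_clockwiseMove_of_relHeight_pos h
    exact absurd hu (ht u)

/-- Clockwise moves raise the total height, hence every chain of counterclockwise moves ends. -/
theorem wellFounded_clockwiseMove : WellFounded (ClockwiseMove : U.ClockState → _ → Prop) := by
  obtain ⟨r⟩ := U.nonempty_clockState
  have hlt (s t : U.ClockState) (h : ClockwiseMove s t) :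
      ∑ x, relHeight r s x < ∑ x, relHeight r t x := by
    obtain ⟨x, hx⟩ := h.exists_relHeight_pos
    refine Finset.sum_lt_sum (fun y _ => ?_) ⟨x, Finset.mem_univ x, ?_⟩
    · linarith [relHeight_add r s t y, h.relHeight_nonneg y]
    · linarith [relHeight_add r s t x]
  exact Subrelation.wf (fun {s t} h => hlt s t h)
    (Finite.wellFounded_of_trans_of_irrefl
      fun s t : U.ClockState => ∑ x, relHeight r s x < ∑ x, relHeight r t x)

theorem exists_isClocked_reaches (s : U.ClockState) :
    ∃ s₀ : U.ClockState, s₀.IsClocked ∧ Relation.ReflTransGen ClockwiseMove s₀ s := by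
  apply wellFounded_clockwiseMove.induction s
  intro s ih
  by_cases hs : s.IsClocked
  · exact ⟨s, hs, .refl⟩
  · obtain ⟨t, ht⟩ : ∃ t, ClockwiseMove t s := by
      unfold IsClocked CounterclockwiseMove at hs
      push Not at hs
      exact hs
    obtain ⟨s₀, h₀, hr⟩ := ih t ht
    exact ⟨s₀, h₀, hr.tail ht⟩

end LinkoidUniverse.ClockState

theorem mainTheorem5 {C : Type*} [Finite C] (U : LinkoidUniverse C) :
    ∃ s₀ : U.ClockState, s₀.IsClocked ∧ (∀ s : U.ClockState, s.IsClocked → s = s₀) ∧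
      ∀ s : U.ClockState,
        Relation.ReflTransGen LinkoidUniverse.ClockState.ClockwiseMove s₀ s := by
  have := Fintype.ofFinite C
  obtain ⟨r⟩ := U.nonempty_clockState
  obtain ⟨s₀, h₀, -⟩ := r.exists_isClocked_reaches
  refine ⟨s₀, h₀, fun s hs => LinkoidUniverse.ClockState.eq_of_isClocked hs h₀, fun s => ?_⟩
  obtain ⟨s₁, h₁, hr⟩ := s.exists_isClocked_reaches
  rwa [LinkoidUniverse.ClockState.eq_of_isClocked h₁ h₀] at hr
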